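/- Let $G$ be a countable discrete group and let $X$ be a flow space for $G$, i.e. a metric space with a continuous action of $G\times\mathbb{R}$ such that the action of $G$ is isometric and proper (for every compact $K\subseteq X$ the set $\{g\in G\mid K\cap gK\neq\emptyset\}$ is finite). Assume that $X$ is second-countable and locally compact. Write $\Phi_t x$ for the action of $t\in\mathbb{R}$ on $x\in X$ and $\Phi_{\mathbb{R}}(x)=\{\Phi_t x\mid t\in\mathbb{R}\}$ for the flow line through $x$. The $G$-period of $x$ is $\inf\{t>0\mid \Phi_t x\in Gx\}\in[0,\infty]$ (with $\inf\emptyset=\infty$), that is, the period of $Gx$ under the flow induced on $G\backslash X$. For $\gamma\in\mathbb{R}$ let \[X_{cyc}=X_{cyc,\gamma}=\{x\in X\mid \Phi_t x=x\text{ for some }t>0,\text{ and the }G\text{-period of }x\text{ is at most }\gamma\}.\] Call a subset $U$ a $\mathcal{F}in$-subset if $gU\cap U\neq\emptyset$ implies $gU=U$ for all $g\in G$, and the group $\{g\in G\mid gU=U\}$ is finite. Then for every $\gamma\in\mathbb{R}$ there is a $G$-invariant collection $\mathcal{V}_{cyc}$ of $\mathcal{F}in$-subsets of $X_{cyc}$,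 each of them open in $X_{cyc}$, such that the dimension of $\mathcal{V}_{cyc}$ is at most $2\dim(X)+1$, and for every $x\in X_{cyc}$ there is a $V\in\mathcal{V}_{cyc}$ with $\Phi_{\mathbb{R}}(x)\subseteq V$. Here a collection of subsets has dimension at most $n$ if every point lies in at most $n+1$ of its members, and $\dim(X)\in\{-1,0,1,\dots,\infty\}$ is the covering dimension of $X$: the least $d$ such that every open cover of $X$ has an open refinement covering $X$ of dimension at most $d$. -/

import Mathlib

open scoped Pointwise

/-- The data of a flow commuting with the action of `G`; together with the action of `G`
on `X` this is an action of `G × ℝ` on `X`. -/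
structure EquivariantFlow (G X : Type*) [Group G] [TopologicalSpace X] [MulAction G X]
    extends Flow ℝ X where
  map_smul' : ∀ (t : ℝ) (g : G) (x : X), toFun t (g • x) = g • toFun t x

/-- The period `inf {t > 0 | φ t x = x}` of a point, equal to `⊤` if there is no such `t`. -/
noncomputable def flowPeriod {α : Type*} (φ : ℝ → α → α) (x : α) : EReal :=
  sInf ((fun t : ℝ => (t : EReal)) '' {t : ℝ | 0 < t ∧ φ t x = x})

namespace EquivariantFlow

variable {G X : Type*} [Group G] [TopologicalSpace X] [MulAction G X]

/-- The flow induced on the quotient `G \ X`. -/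
def quotientFlow (Φ : EquivariantFlow G X) (t : ℝ) :
    MulAction.orbitRel.Quotient G X → MulAction.orbitRel.Quotient G X :=
  Quotient.map (Φ.toFlow t) (by
    rintro x y ⟨g, hg⟩
    exact ⟨g, by rw [← hg]; exact (Φ.map_smul' t g y).symm⟩)

/-- The `G`-period of `x`: the period of `Gx` under the induced flow on `G \ X`. -/
noncomputable def gPeriod (Φ : EquivariantFlow G X) (x : X) : EReal :=
  flowPeriod Φ.quotientFlow (Quotient.mk (MulAction.orbitRel G X) x)

/-- The points on compact flow lines: `{x | ∃ t > 0, Φ_t x = x}`. -/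
def periodicSet (Φ : EquivariantFlow G X) : Set X :=
  {x | ∃ t : ℝ, 0 < t ∧ Φ.toFlow t x = x}

/-- The points of `G`-period at most `γ`. -/
def gPeriodLE (Φ : EquivariantFlow G X) (γ : ℝ) : Set X :=
  {x | Φ.gPeriod x ≤ (γ : EReal)}

/-- `X_cyc`: the points on compact flow lines with `G`-period at most `γ`. -/
def cyc (Φ : EquivariantFlow G X) (γ : ℝ) : Set X :=
  Φ.periodicSet ∩ Φ.gPeriodLE γ

end EquivariantFlow

/-- `U` is an `ℱ`-subset, for a family `ℱ` of subgroups of `G`: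
`gU ∩ U ≠ ∅` implies `gU = U`, and the stabilizer `{g | gU = U}` belongs to `ℱ`. -/
def IsFamilySubset {G X : Type*} [Group G] [MulAction G X] (ℱ : Set (Subgroup G))
    (U : Set X) : Prop :=
  (∀ g : G, (g • U ∩ U).Nonempty → g • U = U) ∧ MulAction.stabilizer G U ∈ ℱ

/-- The family of all finite subgroups of `G`. -/
def finSubgroups (G : Type*) [Group G] : Set (Subgroup G) :=
  {H | Finite H}

/-- The dimension of a collection of subsets of `X`: the supremum of all `n` such that some
`n + 1` distinct members have a common point; it is `⊥` (read: `-1`) if there is no such `n`. -/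
noncomputable def collectionDim {X : Type*} (𝒱 : Set (Set X)) : WithBot ℕ∞ :=
  sSup {d | ∃ (n : ℕ) (s : Finset (Set X)), d = ((n : ℕ∞) : WithBot ℕ∞) ∧
    (↑s : Set (Set X)) ⊆ 𝒱 ∧ s.card = n + 1 ∧ (⋂₀ (↑s : Set (Set X))).Nonempty}

/-- `𝒰` is an open cover of `X`. -/
def IsOpenCovering {X : Type*} [TopologicalSpace X] (𝒰 : Set (Set X)) : Prop :=
  (∀ U ∈ 𝒰, IsOpen U) ∧ ⋃₀ 𝒰 = Set.univ

/-- The covering dimension of `X`: the least `d` such that every open cover of `X` has an open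
refinement covering `X` of dimension at most `d`; it is `⊥` (read: `-1`) if `X` is empty. -/
noncomputable def coveringDim (X : Type*) [TopologicalSpace X] : WithBot ℕ∞ :=
  sInf {d | ∀ 𝒰 : Set (Set X), IsOpenCovering 𝒰 →
    ∃ 𝒱 : Set (Set X), IsOpenCovering 𝒱 ∧ (∀ V ∈ 𝒱, ∃ U ∈ 𝒰, V ⊆ U) ∧ collectionDim 𝒱 ≤ d}

/-!
The set `X_cyc` splits into the closed set `F` of fixed points of the flow and its relatively open
complement `B`. On each of the two pieces there is an invariant cover by `ℱin`-subsets of dimension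
at most `d = dim X`, and `(d + 1) + (d + 1) = (2 d + 1) + 1` gives the bound for `X_cyc`. The cover
of `F` consists of open subsets of `F`; it is extended to open subsets of `X` by `metricExtension`,
which is `G`-equivariant because the action is isometric and which creates no new intersections.

Let `Y` be `F` or `B`. Both are locally closed in `X` and invariant, and their periods are locally
bounded: a point of `X_cyc` returns to its `G`-orbit within bounded time, by properness locally only
finitely many `g ∈ G` occur in such a return, and they have finite order
(`eventually_finOrderReturn_period_le`, `mem_finOrderReturn_of_mem_closure`). Therefore the quotient
`W` of `Y` by `G × ℝ` is a locally compact Hausdorff space with countable basis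
(`LocallyBoundedPeriods.t2Space`), and every flow line in `Y` has an open flow-invariant
neighbourhood that is a `ℱin`-subset (`LocallyBoundedPeriods.exists_isFamilySubset`). An open cover
of `W` of dimension at most `d` that is subordinate to the images of these neighbourhoods pulls back
to the desired cover of `Y` (`LocallyBoundedPeriods.exists_cover`).

It remains to see that `dim W ≤ d`. Through each point of `Y` there is a slice: a locally closed set
on which `Y → W` is open with finite fibres. For `F` a relatively compact open set will do; for `B`
one takes a level set of the function `z ↦ ∫₀^τ d(Φ_s z, x) ds`, which increases along the flow near
`x` if `Φ_τ x ≠ x`. A slice is a countable union of compact sets that inject into `W`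
(`IsSlice.exists_countable_isCompact_injOn`). Thus `W` is a countable union of compact sets
homeomorphic to compact subsets of `X`, and the countable sum theorem of dimension theory
(`exists_refinement_of_iUnion_dimLEOn`) applies.
-/

open Set Topology Filter

/-! ### Covering dimension and the countable sum theorem -/

/-- A subset `C` of `W` has dimension at most `d` relative to `W` if every sequence of open subsets
of `W` covering `C` can be shrunk to a sequence of open subsets of `W` that still covers `C` and has
at most `d + 1` members through each point of `C`. Nothing is asked at points outside `C`. -/
def DimLEOn {W : Type*} [TopologicalSpace W] (d : ℕ∞) (C : Set W) : Prop :=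
  ∀ U : ℕ → Set W, (∀ j, IsOpen (U j)) → C ⊆ ⋃ j, U j →
    ∃ V : ℕ → Set W, (∀ j, IsOpen (V j)) ∧ (∀ j, V j ⊆ U j) ∧ C ⊆ ⋃ j, V j ∧
      ∀ w ∈ C, ∀ s : Finset ℕ, (∀ j ∈ s, w ∈ V j) → (s.card : ℕ∞) ≤ d + 1

theorem collectionDim_le_iff {X : Type*} {𝒱 : Set (Set X)} {d : ℕ∞} :
    collectionDim 𝒱 ≤ d ↔ ∀ s : Finset (Set X), (↑s : Set (Set X)) ⊆ 𝒱 →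
      (⋂₀ (↑s : Set (Set X))).Nonempty → (s.card : ℕ∞) ≤ d + 1 := by
  unfold collectionDim
  rw [sSup_le_iff]
  constructor
  · intro h s hs hne
    rcases Nat.eq_zero_or_pos s.card with h0 | h0
    · simp [h0]
    · obtain ⟨n, hn⟩ : ∃ n, s.card = n + 1 := ⟨s.card - 1, by omega⟩
      have := h _ ⟨n, s, rfl, hs, hn, hne⟩
      have h2 : (n : ℕ∞) ≤ d := by exact_mod_cast this
      rw [hn]; push_cast
      gcongr
  · rintro h _ ⟨n, s, rfl, hs, hn, hne⟩
    have := h s hs hne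
    rw [hn] at this; push_cast at this
    have h2 : (n : ℕ∞) ≤ d := (ENat.add_le_add_iff_right (by simp)).1 this
    exact_mod_cast h2

theorem collectionDim_union_le {X : Type*} {𝒱 𝒲 : Set (Set X)} {d e : ℕ∞}
    (h𝒱 : collectionDim 𝒱 ≤ d) (h𝒲 : collectionDim 𝒲 ≤ e) :
    collectionDim (𝒱 ∪ 𝒲) ≤ (d + e + 1 : ℕ∞) := by
  classical
  rw [collectionDim_le_iff] at *
  intro s hs hne
  have h1 := h𝒱 (s.filter (· ∈ 𝒱)) (fun V hV => by simpa using (Finset.mem_filter.1 hV).2)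
    (hne.mono (sInter_subset_sInter (Finset.coe_subset.2 (Finset.filter_subset _ _))))
  have h2 := h𝒲 (s.filter (· ∉ 𝒱))
    (fun V hV => (hs (Finset.mem_filter.1 hV).1).resolve_left (Finset.mem_filter.1 hV).2)
    (hne.mono (sInter_subset_sInter (Finset.coe_subset.2 (Finset.filter_subset _ _))))
  rw [← Finset.card_filter_add_card_filter_not (s := s) (· ∈ 𝒱)]
  push_cast
  refine (add_le_add h1 h2).trans (le_of_eq ?_)
  ring

theorem exists_refinement_collectionDim_le {X : Type*} [TopologicalSpace X] {d : WithBot ℕ∞}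
    (hd : coveringDim X = d) {𝒰 : Set (Set X)} (h𝒰 : IsOpenCovering 𝒰) :
    ∃ 𝒱 : Set (Set X), IsOpenCovering 𝒱 ∧ (∀ V ∈ 𝒱, ∃ U ∈ 𝒰, V ⊆ U) ∧ collectionDim 𝒱 ≤ d := by
  have hmem : coveringDim X ∈ {d : WithBot ℕ∞ | ∀ 𝒰 : Set (Set X), IsOpenCovering 𝒰 →
      ∃ 𝒱 : Set (Set X), IsOpenCovering 𝒱 ∧ (∀ V ∈ 𝒱, ∃ U ∈ 𝒰, V ⊆ U) ∧
        collectionDim 𝒱 ≤ d} :=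
    csInf_mem ⟨⊤, fun 𝒰 h𝒰 => ⟨𝒰, h𝒰, fun V hV => ⟨V, hV, subset_rfl⟩, le_top⟩⟩
  rw [← hd]
  exact hmem 𝒰 h𝒰

theorem isEmpty_of_coveringDim_eq_bot {X : Type*} [TopologicalSpace X] (h : coveringDim X = ⊥) :
    IsEmpty X := by
  by_contra hne
  rw [not_isEmpty_iff] at hne
  obtain ⟨x⟩ := hne
  obtain ⟨𝒱, h𝒱, -, hd⟩ := exists_refinement_collectionDim_le h
    (𝒰 := {univ}) ⟨by simp, by simp⟩
  obtain ⟨V, hV, hx⟩ : ∃ V ∈ 𝒱, x ∈ V := by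
    have : x ∈ ⋃₀ 𝒱 := h𝒱.2 ▸ mem_univ x
    exact this
  have h0 : ((0 : ℕ∞) : WithBot ℕ∞) ≤ collectionDim 𝒱 :=
    le_sSup ⟨0, {V}, by simp, by simpa using hV, by simp, ⟨x, by simpa using hx⟩⟩
  exact absurd (h0.trans hd) (by simp)

/-- The dimension of a closed subset is at most that of the space: adjoin the complement of the
subset to the cover, refine, and amalgamate all members that lie in the same set of the cover. -/
theorem IsClosed.dimLEOn {X : Type*} [TopologicalSpace X] {d : ℕ∞}
    (hd : coveringDim X = d) {K : Set X} (hK : IsClosed K) : DimLEOn d K := by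
  classical
  intro U hU hKU
  obtain ⟨𝒱, h𝒱, href, hdim⟩ := exists_refinement_collectionDim_le hd
    (𝒰 := insert Kᶜ (range U)) ⟨by
      rintro V (rfl | ⟨j, rfl⟩)
      exacts [hK.isOpen_compl, hU j], by
      rw [sUnion_insert, sUnion_range]
      exact eq_univ_of_forall fun x => (em (x ∈ K)).elim (fun h => Or.inr (hKU h)) Or.inl⟩
  rw [collectionDim_le_iff] at hdim
  -- `S j` collects the members of the refinement whose first ambient set is `U j`.
  let S : ℕ → Set (Set X) := fun j => {V | V ∈ 𝒱 ∧ V ⊆ U j ∧ ∀ i < j, ¬ V ⊆ U i}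
  refine ⟨fun j => ⋃₀ S j, fun j => isOpen_sUnion fun V hV => h𝒱.1 V hV.1,
    fun j => sUnion_subset fun V hV => hV.2.1, fun x hx => ?_, fun x hx s hs => ?_⟩
  · obtain ⟨V, hV, hxV⟩ : ∃ V ∈ 𝒱, x ∈ V := (h𝒱.2 ▸ mem_univ x : x ∈ ⋃₀ 𝒱)
    obtain ⟨_, rfl | ⟨j, rfl⟩, hVU⟩ := href V hV
    · exact absurd hx (hVU hxV)
    · have hex : ∃ j, V ⊆ U j := ⟨j, hVU⟩
      exact mem_iUnion.2 ⟨Nat.find hex, V, ⟨hV, Nat.find_spec hex, fun i hi => Nat.find_min hex hi⟩,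
        hxV⟩
  · choose! f hf hxf using hs
    have hinj : InjOn f s := by
      intro i hi j hj hij
      rcases lt_trichotomy i j with h | h | h
      · exact absurd (hij ▸ (hf i hi).2.1) ((hf j hj).2.2 i h)
      · exact h
      · exact absurd (hij ▸ (hf j hj).2.1 : f i ⊆ U j) ((hf i hi).2.2 j h)
    rw [← Finset.card_image_of_injOn hinj]
    refine hdim _ ?_ ⟨x, ?_⟩
    · intro V hV
      obtain ⟨j, hj, rfl⟩ := by simpa using hV
      exact (hf j hj).1
    · intro V hV
      obtain ⟨j, hj, rfl⟩ := by simpa using hV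
      exact hxf j hj

/-- A continuous map that is injective on a compact set does not raise its dimension. -/
theorem DimLEOn.image {Y W : Type*} [TopologicalSpace Y] [TopologicalSpace W] [T2Space W] {d : ℕ∞}
    {K : Set Y} (hd : DimLEOn d K) (hK : IsCompact K) {q : Y → W} (hq : Continuous q)
    (hinj : InjOn q K) : DimLEOn d (q '' K) := by
  intro U hU hKU
  obtain ⟨V, hV, hVU, hKV, hord⟩ := hd (fun j => q ⁻¹' U j) (fun j => (hU j).preimage hq)
    (by rwa [← preimage_iUnion, ← image_subset_iff])
  -- On `q '' K` the open set `U j \ q '' (K \ V j)` is the image of `K ∩ V j`.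
  refine ⟨fun j => U j \ q '' (K \ V j),
    fun j => (hU j).sdiff ((hK.diff (hV j)).image hq).isClosed, fun j => sdiff_subset, ?_, ?_⟩
  · rintro _ ⟨x, hx, rfl⟩
    obtain ⟨j, hj⟩ := mem_iUnion.1 (hKV hx)
    refine mem_iUnion.2 ⟨j, hVU j hj, ?_⟩
    rintro ⟨y, hy, hyx⟩
    exact hy.2 (hinj hy.1 hx hyx ▸ hj)
  · rintro _ ⟨x, hx, rfl⟩ s hs
    refine hord x hx s fun j hj => ?_
    by_contra hxj
    exact (hs j hj).2 ⟨x, ⟨hx, hxj⟩, rfl⟩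

theorem DimLEOn.of_image {Y X : Type*} [TopologicalSpace Y] [TopologicalSpace X] {d : ℕ∞}
    {K : Set Y} {e : Y → X} (he : IsInducing e) (hd : DimLEOn d (e '' K)) : DimLEOn d K := by
  intro U hU hKU
  choose U' hU' hUU' using fun j => he.isOpen_iff.1 (hU j)
  obtain ⟨V, hV, hVU, hKV, hord⟩ := hd U' hU' (by
    rw [image_subset_iff, preimage_iUnion]
    simpa only [hUU'] using hKU)
  refine ⟨fun j => e ⁻¹' V j, fun j => (hV j).preimage he.continuous,
    fun j => (preimage_mono (hVU j)).trans (hUU' j).subset, ?_, fun y hy s hs =>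
      hord (e y) (mem_image_of_mem e hy) s hs⟩
  rwa [← preimage_iUnion, ← image_subset_iff]

/-- One step of the sum theorem: a locally finite open cover can be shrunk so that the closures of
its members have order at most `d + 1` on a given closed set of dimension at most `d`. -/
theorem DimLEOn.exists_shrinking {W : Type*} [TopologicalSpace W] [NormalSpace W] {d : ℕ∞}
    {C : Set W} (hC : IsClosed C) (hd : DimLEOn d C) {U : ℕ → Set W} (hU : ∀ j, IsOpen (U j))
    (hfin : LocallyFinite U) (hcov : ⋃ j, U j = univ) :
    ∃ V : ℕ → Set W, (∀ j, IsOpen (V j)) ∧ (⋃ j, V j = univ) ∧ (∀ j, closure (V j) ⊆ U j) ∧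
      ∀ w ∈ C, ∀ s : Finset ℕ, (∀ j ∈ s, w ∈ closure (V j)) → (s.card : ℕ∞) ≤ d + 1 := by
  obtain ⟨E, hE, hEU, hCE, hord⟩ := hd U hU (hcov ▸ subset_univ C)
  have hsub : ∀ j, U j \ C ∪ E j ⊆ U j := fun j => union_subset sdiff_subset (hEU j)
  obtain ⟨V, hVc, hVo, hV⟩ := exists_iUnion_eq_closure_subset (u := fun j => U j \ C ∪ E j)
    (fun j => ((hU j).sdiff hC).union (hE j))
    (fun x => (hfin.point_finite x).subset fun j hj => hsub j hj) (by
      refine eq_univ_of_forall fun x => ?_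
      by_cases hx : x ∈ C
      · obtain ⟨j, hj⟩ := mem_iUnion.1 (hCE hx)
        exact mem_iUnion.2 ⟨j, Or.inr hj⟩
      · obtain ⟨j, hj⟩ := mem_iUnion.1 (hcov ▸ mem_univ x : x ∈ ⋃ j, U j)
        exact mem_iUnion.2 ⟨j, Or.inl ⟨hj, hx⟩⟩)
  refine ⟨V, hVo, hVc, fun j => (hV j).trans (hsub j), fun w hw s hs => hord w hw s fun j hj => ?_⟩
  exact (hV j (hs j hj)).resolve_left fun h => h.2 hw

/-- A locally finite family of closed sets of order at most `n` in a metric space can be thickened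
to a family of open sets of order at most `n`: around each point `w` take the ball of half the
radius of a ball meeting only those members that contain `w`. -/
theorem LocallyFinite.exists_open_thickening {W : Type*} [MetricSpace W] {n : ℕ∞}
    {D : ℕ → Set W} (hD : ∀ j, IsClosed (D j)) (hfin : LocallyFinite D)
    (hord : ∀ w, ∀ s : Finset ℕ, (∀ j ∈ s, w ∈ D j) → (s.card : ℕ∞) ≤ n) :
    ∃ E : ℕ → Set W, (∀ j, IsOpen (E j)) ∧ (∀ j, D j ⊆ E j) ∧
      ∀ w, ∀ s : Finset ℕ, (∀ j ∈ s, w ∈ E j) → (s.card : ℕ∞) ≤ n := by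
  have hr : ∀ w, ∃ r > 0, ∀ z, dist z w < 2 * r → ∀ j, z ∈ D j → w ∈ D j := by
    intro w
    have hnhds := hfin.iInter_compl_mem_nhds hD w
    obtain ⟨ε, hε, hball⟩ := Metric.mem_nhds_iff.1 hnhds
    refine ⟨ε / 2, by positivity, fun z hz j hzj => ?_⟩
    by_contra hwj
    have := hball (Metric.mem_ball.2 (by linarith : dist z w < ε))
    simp only [mem_iInter] at this
    exact this j hwj hzj
  choose r hr0 hr using hr
  refine ⟨fun j => ⋃ w ∈ D j, Metric.ball w (r w),
    fun j => isOpen_biUnion fun w _ => Metric.isOpen_ball,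
    fun j w hw => mem_biUnion hw (Metric.mem_ball_self (hr0 w)), fun z s hs => ?_⟩
  rcases s.eq_empty_or_nonempty with rfl | hne
  · simp
  have hs' : ∀ j ∈ s, ∃ w ∈ D j, dist z w < r w := fun j hj => by simpa using hs j hj
  have : Nonempty W := ⟨z⟩
  choose! p hp hpz using hs'
  -- The centre with the largest radius lies in all the members under consideration.
  obtain ⟨m, hm, hmax⟩ := s.exists_max_image (fun j => r (p j)) hne
  refine hord (p m) s fun j hj => hr (p m) (p j) ?_ j (hp j hj)
  have h1 := hpz j hj
  have h2 := hpz m hm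
  have h3 := hmax j hj
  have h4 := dist_triangle_left (p j) (p m) z
  linarith

/-- The countable sum theorem of dimension theory: if a metrizable space with countable basis is a
countable union of closed sets of dimension at most `d`, then its covering dimension is at
most `d`. -/
theorem exists_refinement_of_iUnion_dimLEOn {W : Type*} [MetricSpace W]
    [SecondCountableTopology W] {d : ℕ∞} {C : ℕ → Set W} (hC : ∀ n, IsClosed (C n))
    (hd : ∀ n, DimLEOn d (C n)) (hCW : ⋃ n, C n = univ) {U : W → Set W} (hU : ∀ w, U w ∈ 𝓝 w) :
    ∃ V : ℕ → Set W, (∀ j, IsOpen (V j)) ∧ (⋃ j, V j = univ) ∧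
      (∀ j, (V j).Nonempty → ∃ w, V j ⊆ U w) ∧
      ∀ w, ∀ s : Finset ℕ, (∀ j ∈ s, w ∈ V j) → (s.card : ℕ∞) ≤ d + 1 := by
  rcases isEmpty_or_nonempty W with hW | hW
  · exact ⟨fun _ => ∅, by simp, Subsingleton.elim _ _, by simp, fun w => hW.elim w⟩
  obtain ⟨T, hTc, hT⟩ := TopologicalSpace.countable_cover_nhds
    (f := fun w => interior (U w)) fun w => interior_mem_nhds.2 (hU w)
  have hTne : T.Nonempty := by
    by_contra h
    rw [not_nonempty_iff_eq_empty] at h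
    simp [h] at hT
    exact hW.elim fun w => absurd (hT ▸ mem_univ w : w ∈ (∅ : Set W)) (by simp)
  obtain ⟨c, rfl⟩ := hTc.exists_eq_range hTne
  obtain ⟨U₀, hU₀, hU₀c, hU₀f, hU₀U⟩ := precise_refinement (fun n => interior (U (c n)))
    (fun _ => isOpen_interior) (by simpa using hT)
  -- Successive shrinkings `f n` of the cover, the closures of `f (n + 1)` having small order on
  -- `C n`.
  let A := {V : ℕ → Set W // (∀ j, IsOpen (V j)) ∧ (⋃ j, V j = univ) ∧ LocallyFinite V}
  have step : ∀ (n : ℕ) (V : A), ∃ V' : A, (∀ j, closure (V'.1 j) ⊆ V.1 j) ∧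
      ∀ w ∈ C n, ∀ s : Finset ℕ, (∀ j ∈ s, w ∈ closure (V'.1 j)) → (s.card : ℕ∞) ≤ d + 1 := by
    rintro n ⟨V, hVo, hVc, hVf⟩
    obtain ⟨V', h1, h2, h3, h4⟩ := (hd n).exists_shrinking (hC n) hVo hVf hVc
    exact ⟨⟨V', h1, h2, hVf.subset fun j => subset_closure.trans (h3 j)⟩, h3, h4⟩
  choose F hF hFo using step
  let f : ℕ → A := fun n => Nat.rec ⟨U₀, hU₀, hU₀c, hU₀f⟩ F n
  have hcl : ∀ n j, closure ((f (n + 1)).1 j) ⊆ (f n).1 j := fun n => hF n (f n)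
  have hanti : ∀ j, Antitone fun n => (f n).1 j := fun j =>
    antitone_nat_of_succ_le fun n => subset_closure.trans (hcl n j)
  let D : ℕ → Set W := fun j => ⋂ n, (f n).1 j
  have hDU : ∀ j, D j ⊆ U₀ j := fun j => iInter_subset (fun n => (f n).1 j) 0
  have hDeq : ∀ j, D j = ⋂ n, closure ((f (n + 1)).1 j) := fun j =>
    Subset.antisymm
      (subset_iInter fun n => (iInter_subset (fun n => (f n).1 j) (n + 1)).trans subset_closure)
      (subset_iInter fun n => (iInter_subset _ n).trans (hcl n j))
  have hDclosed : ∀ j, IsClosed (D j) := fun j => by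
    rw [hDeq]
    exact isClosed_iInter fun n => isClosed_closure
  have hDcov : ∀ w, ∃ j, w ∈ D j := by
    intro w
    by_contra! hw
    have hw' : ∀ j, ∃ n, w ∉ (f n).1 j := fun j => by simpa [D] using hw j
    choose N hN using hw'
    -- Only finitely many members of the first cover contain `w`, so some stage omits them all.
    obtain ⟨M, hM⟩ := ((hU₀f.point_finite w).image N).bddAbove
    obtain ⟨j, hj⟩ := mem_iUnion.1 ((f M).2.2.1.symm.subset (mem_univ w))
    have hj0 : w ∈ U₀ j := hanti j (Nat.zero_le M) hj
    exact hN j (hanti j (hM (mem_image_of_mem N hj0)) hj)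
  obtain ⟨E, hE, hDE, hEord⟩ := (hU₀f.subset hDU).exists_open_thickening (n := d + 1) hDclosed (by
    intro w s hs
    obtain ⟨n, hn⟩ := mem_iUnion.1 (hCW ▸ mem_univ w : w ∈ ⋃ n, C n)
    refine hFo n (f n) w hn s fun j hj => ?_
    have := hs j hj
    rw [hDeq] at this
    exact mem_iInter.1 this n)
  refine ⟨fun j => E j ∩ U₀ j, fun j => (hE j).inter (hU₀ j), ?_, fun j _ => ⟨c j,
    inter_subset_right.trans ((hU₀U j).trans interior_subset)⟩,
    fun w s hs => hEord w s fun j hj => (hs j hj).1⟩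
  refine eq_univ_of_forall fun w => ?_
  obtain ⟨j, hj⟩ := hDcov w
  exact mem_iUnion.2 ⟨j, hDE j hj, hDU j hj⟩

/-! ### Flows with locally bounded periods and their orbit spaces -/

namespace EquivariantFlow

variable {G Y : Type*} [Group G] [TopologicalSpace Y] [MulAction G Y]

theorem map_smul (Φ : EquivariantFlow G Y) (t : ℝ) (g : G) (x : Y) :
    Φ.toFlow t (g • x) = g • Φ.toFlow t x := Φ.map_smul' t g x

theorem periodic (Φ : EquivariantFlow G Y) {p : ℝ} {x : Y} (hp : Φ.toFlow p x = x) :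
    Function.Periodic (fun t => Φ.toFlow t x) p := fun t => by
  change Φ.toFlow (t + p) x = Φ.toFlow t x
  rw [Flow.map_add, hp]

/-- Every point has a neighbourhood on which all points are periodic with a common bound for some
positive period. -/
def LocallyBoundedPeriods (Φ : EquivariantFlow G Y) : Prop :=
  ∀ x, ∃ P : ℝ, ∀ᶠ y in 𝓝 x, ∃ p, 0 < p ∧ p ≤ P ∧ Φ.toFlow p y = y

theorem exists_mem_Icc_flow_eq (Φ : EquivariantFlow G Y) {P : ℝ} {x : Y}
    (h : ∃ p, 0 < p ∧ p ≤ P ∧ Φ.toFlow p x = x) (t : ℝ) :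
    ∃ s ∈ Icc 0 P, Φ.toFlow s x = Φ.toFlow t x := by
  obtain ⟨p, hp, hpP, hpx⟩ := h
  obtain ⟨s, hs, hst⟩ := (Φ.periodic hpx).exists_mem_Ico₀ hp t
  exact ⟨s, ⟨hs.1, hs.2.le.trans hpP⟩, hst.symm⟩

/-- The equivalence relation on `Y` whose classes are the orbits of `G × ℝ`. -/
def orbitSetoid (Φ : EquivariantFlow G Y) : Setoid Y where
  r x y := ∃ (g : G) (t : ℝ), g • Φ.toFlow t x = y
  iseqv :=
    { refl := fun x => ⟨1, 0, by simp⟩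
      symm := by
        rintro x _ ⟨g, t, rfl⟩
        refine ⟨g⁻¹, -t, ?_⟩
        rw [map_smul, inv_smul_smul, ← Flow.map_add, neg_add_cancel, Flow.map_zero_apply]
      trans := by
        rintro x _ _ ⟨g, t, rfl⟩ ⟨h, s, rfl⟩
        refine ⟨h * g, s + t, ?_⟩
        rw [map_smul, mul_smul, Flow.map_add] }

/-- The projection of `Y` onto its space of `G × ℝ`-orbits. -/
def orbitMk (Φ : EquivariantFlow G Y) (x : Y) : Quotient Φ.orbitSetoid :=
  Quotient.mk Φ.orbitSetoid x

theorem orbitMk_eq_iff (Φ : EquivariantFlow G Y) {x y : Y} :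
    Φ.orbitMk x = Φ.orbitMk y ↔ ∃ (g : G) (t : ℝ), g • Φ.toFlow t x = y :=
  Quotient.eq (r := Φ.orbitSetoid)

theorem orbitMk_smul (Φ : EquivariantFlow G Y) (g : G) (x : Y) :
    Φ.orbitMk (g • x) = Φ.orbitMk x :=
  (Φ.orbitMk_eq_iff.2 ⟨g, 0, by simp⟩).symm

theorem orbitMk_flow (Φ : EquivariantFlow G Y) (t : ℝ) (x : Y) :
    Φ.orbitMk (Φ.toFlow t x) = Φ.orbitMk x :=
  (Φ.orbitMk_eq_iff.2 ⟨1, t, by simp⟩).symm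

/-- If periods are locally bounded, the relation of lying on the same flow line is closed. -/
theorem LocallyBoundedPeriods.isClosed_setOf_flow_eq [T2Space Y] {Φ : EquivariantFlow G Y}
    (hΦ : Φ.LocallyBoundedPeriods) : IsClosed {z : Y × Y | ∃ t, Φ.toFlow t z.1 = z.2} := by
  rw [isClosed_iff_ultrafilter]
  rintro ⟨x, y⟩ u hu hmem
  obtain ⟨P, hP⟩ := hΦ x
  have hfst : Tendsto Prod.fst (u : Filter (Y × Y)) (𝓝 x) :=
    (continuous_fst.tendsto (x, y)).mono_left hu
  have hsnd : Tendsto Prod.snd (u : Filter (Y × Y)) (𝓝 y) :=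
    (continuous_snd.tendsto (x, y)).mono_left hu
  have hev : ∀ᶠ z : Y × Y in u, ∃ s ∈ Icc 0 P, Φ.toFlow s z.1 = z.2 := by
    filter_upwards [hfst.eventually hP, hmem] with z hz hz'
    obtain ⟨t, ht⟩ := hz'
    rw [← ht]
    exact Φ.exists_mem_Icc_flow_eq hz t
  choose! s hs hsz using fun (z : Y × Y) (h : ∃ s ∈ Icc 0 P, Φ.toFlow s z.1 = z.2) => h
  obtain ⟨t, -, ht⟩ := (isCompact_Icc (a := (0 : ℝ)) (b := P)).ultrafilter_le_nhds (u.map s)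
    (by
      rw [le_principal_iff]
      exact hev.mono fun z hz => hs z hz)
  have ht' : Tendsto s u (𝓝 t) := ht
  refine ⟨t, tendsto_nhds_unique (l := (u : Filter (Y × Y)))
    (f := fun z => Φ.toFlow (s z) z.1) ?_ ?_⟩
  · exact (Φ.toFlow.cont'.tendsto (t, x)).comp (ht'.prodMk_nhds hfst)
  · exact hsnd.congr' (hev.mono fun z hz => (hsz z hz).symm)

/-- If periods are locally bounded, the union of the flow lines through a compact set lies in a
compact set. -/
theorem LocallyBoundedPeriods.exists_isCompact_flow_mem {Φ : EquivariantFlow G Y}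
    (hΦ : Φ.LocallyBoundedPeriods) {K : Set Y} (hK : IsCompact K) :
    ∃ K' : Set Y, IsCompact K' ∧ ∀ a ∈ K, ∀ t, Φ.toFlow t a ∈ K' := by
  have : ∃ P : ℝ, ∀ y ∈ K, ∃ p, 0 < p ∧ p ≤ P ∧ Φ.toFlow p y = y := by
    refine hK.induction_on (p := fun K => ∃ P : ℝ, ∀ y ∈ K, ∃ p, 0 < p ∧ p ≤ P ∧ Φ.toFlow p y = y)
      ⟨0, by simp⟩ (fun s t hst ⟨P, hP⟩ => ⟨P, fun y hy => hP y (hst hy)⟩) ?_ ?_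
    · rintro s t ⟨P, hP⟩ ⟨Q, hQ⟩
      refine ⟨max P Q, ?_⟩
      rintro y (hy | hy)
      · obtain ⟨p, h0, h1, h2⟩ := hP y hy
        exact ⟨p, h0, h1.trans (le_max_left _ _), h2⟩
      · obtain ⟨p, h0, h1, h2⟩ := hQ y hy
        exact ⟨p, h0, h1.trans (le_max_right _ _), h2⟩
    · intro x _
      obtain ⟨P, hP⟩ := hΦ x
      exact ⟨_, mem_nhdsWithin_of_mem_nhds hP, P, fun y hy => hy⟩
  obtain ⟨P, hP⟩ := this
  refine ⟨_, ((isCompact_Icc (a := (0 : ℝ)) (b := P)).prod hK).image Φ.toFlow.cont', ?_⟩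
  intro a ha t
  obtain ⟨s, hs, hst⟩ := Φ.exists_mem_Icc_flow_eq (hP a ha) t
  exact ⟨(s, a), ⟨hs, ha⟩, hst⟩

theorem LocallyBoundedPeriods.finite_setOf_smul_flow_mem [ProperlyDiscontinuousSMul G Y]
    {Φ : EquivariantFlow G Y} (hΦ : Φ.LocallyBoundedPeriods) {K L : Set Y}
    (hK : IsCompact K) (hL : IsCompact L) :
    {g : G | ∃ a ∈ K, ∃ t, g • Φ.toFlow t a ∈ L}.Finite := by
  obtain ⟨K', hK', hKK'⟩ := hΦ.exists_isCompact_flow_mem hK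
  refine (ProperlyDiscontinuousSMul.finite_disjoint_inter_image (Γ := G) hK' hL).subset ?_
  rintro g ⟨a, ha, t, hgt⟩
  exact ⟨_, ⟨_, hKK' a ha t, rfl⟩, hgt⟩

variable [ContinuousConstSMul G Y]

theorem isOpenQuotientMap_orbitMk (Φ : EquivariantFlow G Y) : IsOpenQuotientMap Φ.orbitMk := by
  refine ⟨Quotient.mk_surjective, continuous_quotient_mk', fun U hU => ?_⟩
  have : Φ.orbitMk ⁻¹' (Φ.orbitMk '' U) =
      ⋃ (g : G), ⋃ (t : ℝ), {y | g • Φ.toFlow t y ∈ U} := by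
    ext y
    simp only [mem_preimage, mem_image, mem_iUnion, mem_ofPred_eq]
    constructor
    · rintro ⟨x, hx, hxy⟩
      obtain ⟨g, t, rfl⟩ := Φ.orbitMk_eq_iff.1 hxy.symm
      exact ⟨g, t, hx⟩
    · rintro ⟨g, t, h⟩
      exact ⟨_, h, (Φ.orbitMk_smul _ _).trans (Φ.orbitMk_flow _ _)⟩
  change IsOpen (Φ.orbitMk ⁻¹' (Φ.orbitMk '' U))
  rw [this]
  exact isOpen_iUnion fun g => isOpen_iUnion fun t =>
    hU.preimage ((continuous_const_smul g).comp (Φ.toFlow.continuous_toFun t))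

variable [ProperlyDiscontinuousSMul G Y] [LocallyCompactSpace Y] [T2Space Y]

/-- The space of `G × ℝ`-orbits is Hausdorff if periods are locally bounded: the orbit relation is
the union, over `g`, of the translates of the closed relation of lying on the same flow line, and
this union is locally finite because the action of `G` is proper. -/
theorem LocallyBoundedPeriods.t2Space {Φ : EquivariantFlow G Y}
    (hΦ : Φ.LocallyBoundedPeriods) : T2Space (Quotient Φ.orbitSetoid) := by
  rw [t2Space_iff_of_isOpenQuotientMap Φ.isOpenQuotientMap_orbitMk]
  have : {z : Y × Y | Φ.orbitMk z.1 = Φ.orbitMk z.2} =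
      ⋃ g : G, {z : Y × Y | ∃ t, g • Φ.toFlow t z.1 = z.2} := by
    ext z
    simp only [mem_ofPred_eq, mem_iUnion, orbitMk_eq_iff]
  rw [this]
  refine LocallyFinite.isClosed_iUnion ?_ fun g => ?_
  · rintro ⟨x, y⟩
    obtain ⟨K, hK, hxK⟩ := exists_compact_mem_nhds x
    obtain ⟨L, hL, hyL⟩ := exists_compact_mem_nhds y
    refine ⟨K ×ˢ L, prod_mem_nhds hxK hyL, (hΦ.finite_setOf_smul_flow_mem hK hL).subset ?_⟩
    rintro g ⟨⟨a, b⟩, ⟨t, ht⟩, ha, hb⟩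
    exact ⟨a, ha, t, ht ▸ hb⟩
  · have := hΦ.isClosed_setOf_flow_eq.preimage
      (continuous_fst.prodMk ((continuous_const_smul g⁻¹).comp continuous_snd) :
        Continuous fun z : Y × Y => (z.1, g⁻¹ • z.2))
    convert this using 1
    ext z
    simp only [mem_ofPred_eq, mem_preimage]
    exact exists_congr fun t => eq_inv_smul_iff.symm

/-- Every point has an open flow-invariant neighbourhood that is an `ℱ`-subset for the family `ℱ` of
finite subgroups. -/
theorem LocallyBoundedPeriods.exists_isFamilySubset {Φ : EquivariantFlow G Y}
    (hΦ : Φ.LocallyBoundedPeriods) (y : Y) :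
    ∃ S : Set Y, IsOpen S ∧ y ∈ S ∧ (∀ t, ∀ x ∈ S, Φ.toFlow t x ∈ S) ∧
      (∀ g : G, (g • S ∩ S).Nonempty → g • S = S) ∧ {g : G | g • S = S}.Finite := by
  obtain ⟨K, hK, hyK⟩ := exists_compact_mem_nhds y
  let T : Set G := {g : G | ∃ a ∈ K, ∃ t, g • Φ.toFlow t a ∈ K}
  have hTfin : T.Finite := hΦ.finite_setOf_smul_flow_mem hK hK
  -- Elements of `T` moving the flow line of `y` off itself do so uniformly near `y`.
  have hsep : ∀ g ∈ {g ∈ T | ¬ ∃ t, g • Φ.toFlow t y = y},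
      ∃ N ∈ 𝓝 y, ∀ a ∈ N, ∀ b ∈ N, ∀ t, g • Φ.toFlow t a ≠ b := by
    rintro g ⟨-, hg⟩
    have hcl := hΦ.isClosed_setOf_flow_eq.preimage
      (continuous_fst.prodMk ((continuous_const_smul g⁻¹).comp continuous_snd) :
        Continuous fun z : Y × Y => (z.1, g⁻¹ • z.2))
    have hnhds := hcl.isOpen_compl.mem_nhds (x := (y, y)) fun ⟨t, ht⟩ =>
      hg ⟨t, eq_inv_smul_iff.1 ht⟩
    rw [nhds_prod_eq] at hnhds
    obtain ⟨N, hN, hNN⟩ := mem_prod_self_iff.1 hnhds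
    exact ⟨N, hN, fun a ha b hb t h => hNN (mk_mem_prod ha hb) ⟨t, eq_inv_smul_iff.2 h⟩⟩
  choose! N hN hNg using hsep
  have hbad : {g ∈ T | ¬ ∃ t, g • Φ.toFlow t y = y}.Finite := hTfin.subset (sep_subset _ _)
  obtain ⟨O, hON, hO, hyO⟩ := mem_nhds_iff.1 (inter_mem hyK ((biInter_mem hbad).2 hN))
  have key : ∀ g : G, ∀ a ∈ O, ∀ t, g • Φ.toFlow t a ∈ O → ∃ t, g • Φ.toFlow t y = y := by
    intro g a ha t hgt
    by_contra hg
    have hgT : g ∈ {g ∈ T | ¬ ∃ t, g • Φ.toFlow t y = y} :=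
      ⟨⟨a, (hON ha).1, t, (hON hgt).1⟩, hg⟩
    exact hNg g hgT a (mem_iInter₂.1 (hON ha).2 g hgT) _ (mem_iInter₂.1 (hON hgt).2 g hgT) t rfl
  -- `H` is the stabilizer of the flow line through `y`.
  let H : Set G := {g | ∃ t, g • Φ.toFlow t y = y}
  have hHfin : H.Finite := hTfin.subset fun g ⟨t, ht⟩ =>
    ⟨y, mem_of_mem_nhds hyK, t, ht.symm ▸ mem_of_mem_nhds hyK⟩
  have hHmul : ∀ g ∈ H, ∀ h ∈ H, g * h ∈ H := by
    rintro g ⟨t, ht⟩ h ⟨s, hs⟩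
    refine ⟨t + s, ?_⟩
    rw [mul_smul, Flow.map_add, ← map_smul, hs, ht]
  have hHinv : ∀ g ∈ H, g⁻¹ ∈ H := by
    rintro g ⟨t, ht⟩
    refine ⟨-t, ?_⟩
    rw [inv_smul_eq_iff, ← ht, map_smul, ← Flow.map_add, neg_add_cancel, Flow.map_zero_apply, ht]
  let S : Set Y := {x | ∃ h ∈ H, ∃ t, h • Φ.toFlow t x ∈ O}
  have hSmul : ∀ g ∈ H, ∀ x ∈ S, g • x ∈ S := by
    rintro g hg x ⟨h, hh, t, hx⟩
    refine ⟨h * g⁻¹, hHmul _ hh _ (hHinv _ hg), t, ?_⟩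
    rwa [map_smul, mul_smul, inv_smul_smul]
  have hSH : ∀ g ∈ H, g • S = S := fun g hg => by
    refine Subset.antisymm (smul_set_subset_iff.2 fun x hx => hSmul g hg x hx) fun x hx => ?_
    exact mem_smul_set_iff_inv_smul_mem.2 (hSmul _ (hHinv g hg) x hx)
  have hHS : ∀ g : G, (g • S ∩ S).Nonempty → g ∈ H := by
    rintro g ⟨x, hgx, h, hh, t, hx⟩
    obtain ⟨k, hk, s, hxk⟩ := mem_smul_set_iff_inv_smul_mem.1 hgx
    have hmem : h * g * k⁻¹ ∈ H := by
      refine key _ _ hxk (t - s) ?_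
      rwa [map_smul Φ _ k, ← Flow.map_add, sub_add_cancel, mul_smul, mul_smul, inv_smul_smul,
        map_smul, smul_inv_smul]
    have := hHmul _ (hHinv h hh) _ (hHmul _ hmem k hk)
    simpa [mul_assoc] using this
  have hyS : y ∈ S := ⟨1, ⟨0, by simp⟩, 0, by simpa using hyO⟩
  refine ⟨S, ?_, hyS, ?_, fun g hg => hSH g (hHS g hg), hHfin.subset fun g hg =>
    hHS g ⟨y, by rw [show g • S = S from hg]; exact ⟨hyS, hyS⟩⟩⟩
  · have : S = ⋃ h ∈ H, ⋃ t : ℝ, {x | h • Φ.toFlow t x ∈ O} := by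
      ext x; simp [S]
    rw [this]
    exact isOpen_biUnion fun h _ => isOpen_iUnion fun t =>
      hO.preimage ((continuous_const_smul h).comp (Φ.toFlow.continuous_toFun t))
  · rintro t x ⟨h, hh, s, hx⟩
    refine ⟨h, hh, s - t, ?_⟩
    rwa [← Flow.map_add, sub_add_cancel]

end EquivariantFlow

/-! ### Covers pulled back from the orbit space -/

theorem IsFamilySubset.smul_finSubgroups {G X : Type*} [Group G] [MulAction G X] {U : Set X}
    (hU : IsFamilySubset (finSubgroups G) U) (g : G) :
    IsFamilySubset (finSubgroups G) (g • U) := by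
  constructor
  · rintro h ⟨x, hx, hx'⟩
    have := hU.1 (g⁻¹ * h * g) ⟨g⁻¹ • x, by
      rw [mul_smul, mul_smul]; exact smul_mem_smul_set hx, mem_smul_set_iff_inv_smul_mem.1 hx'⟩
    rwa [mul_smul, mul_smul, inv_smul_eq_iff] at this
  · have : Finite (MulAction.stabilizer G U) := hU.2
    change Finite (MulAction.stabilizer G (g • U))
    rw [MulAction.stabilizer_smul_eq_stabilizer_map_conj]
    exact ((MulAction.stabilizer G U : Set G).toFinite.image _).to_subtype

theorem IsLocallyClosed.isSigmaCompact {Y : Type*} [TopologicalSpace Y]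
    [LocallyCompactSpace Y] [SecondCountableTopology Y] {S : Set Y} (hS : IsLocallyClosed S) :
    IsSigmaCompact S := by
  have := hS.locallyCompactSpace
  exact isSigmaCompact_iff_sigmaCompactSpace.2 inferInstance

namespace EquivariantFlow

variable {G Y : Type*} [Group G] [TopologicalSpace Y] [MulAction G Y]

/-- A slice for the action of `G × ℝ`: a locally closed set `S` on which the projection to the orbit
space is open and has finite fibres. -/
structure IsSlice (Φ : EquivariantFlow G Y) (S : Set Y) : Prop where
  isLocallyClosed : IsLocallyClosed S
  isOpen_image : ∀ N, IsOpen N → IsOpen (Φ.orbitMk '' (S ∩ N))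
  finite_fiber : ∀ y, {x ∈ S | Φ.orbitMk x = Φ.orbitMk y}.Finite

variable [LocallyCompactSpace Y] [T2Space Y] [SecondCountableTopology Y]

/-- A slice is a countable union of compact sets on which the projection to the orbit space is
injective. For `U` in a countable basis consider the points of `S ∩ U` that are alone in their fibre
within `S ∩ U`. As the projection is open on `S`, they form a closed subset of `S ∩ U`, and as
fibres are finite, these subsets cover `S`. -/
theorem IsSlice.exists_countable_isCompact_injOn [ContinuousConstSMul G Y]
    {Φ : EquivariantFlow G Y} {S : Set Y}
    (hS : Φ.IsSlice S) : ∃ 𝒦 : Set (Set Y), 𝒦.Countable ∧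
      (∀ K ∈ 𝒦, IsCompact K ∧ InjOn Φ.orbitMk K) ∧ S ⊆ ⋃₀ 𝒦 := by
  have hB := TopologicalSpace.isBasis_countableBasis Y
  let B := TopologicalSpace.countableBasis Y
  let E : Set Y → Set Y := fun U =>
    {x ∈ S ∩ U | ∀ x' ∈ S ∩ U, Φ.orbitMk x' = Φ.orbitMk x → x' = x}
  have hE : ∀ U ∈ B, IsSigmaCompact (E U) := by
    intro U hU
    have hopen : IsOpen (⋃ A ∈ {A ∈ B | A ⊆ U}, ⋃ A' ∈ {A' ∈ B | A' ⊆ U ∧ Disjoint A A'},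
        A ∩ Φ.orbitMk ⁻¹' (Φ.orbitMk '' (S ∩ A'))) :=
      isOpen_biUnion fun A hA => isOpen_biUnion fun A' hA' => (hB.isOpen hA.1).inter
        ((hS.isOpen_image _ (hB.isOpen hA'.1)).preimage Φ.isOpenQuotientMap_orbitMk.continuous)
    have heq : E U = (S ∩ U) ∩ (⋃ A ∈ {A ∈ B | A ⊆ U}, ⋃ A' ∈ {A' ∈ B | A' ⊆ U ∧ Disjoint A A'},
        A ∩ Φ.orbitMk ⁻¹' (Φ.orbitMk '' (S ∩ A')))ᶜ := by
      ext x
      constructor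
      · rintro ⟨hx, hx'⟩
        refine ⟨hx, fun hmem => ?_⟩
        simp only [mem_iUnion] at hmem
        obtain ⟨A, -, A', hA', hxA, y, hy, hyx⟩ := hmem
        have hyx' := hx' y ⟨hy.1, hA'.2.1 hy.2⟩ hyx
        exact disjoint_left.1 hA'.2.2 hxA (hyx' ▸ hy.2)
      · rintro ⟨hx, hx'⟩
        refine ⟨hx, fun y hy hyx => ?_⟩
        by_contra hne
        obtain ⟨O, O', hO, hO', hxO, hyO', hd⟩ := t2_separation (Ne.symm hne)
        obtain ⟨A, hA, hxA, hAO⟩ := hB.exists_subset_of_mem_open (show x ∈ O ∩ U from ⟨hxO, hx.2⟩)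
          (hO.inter (hB.isOpen hU))
        obtain ⟨A', hA', hyA', hAO'⟩ := hB.exists_subset_of_mem_open
          (show y ∈ O' ∩ U from ⟨hyO', hy.2⟩) (hO'.inter (hB.isOpen hU))
        refine hx' ?_
        simp only [mem_iUnion]
        exact ⟨A, ⟨hA, fun z hz => (hAO hz).2⟩, A', ⟨hA', fun z hz => (hAO' hz).2,
          hd.mono (fun z hz => (hAO hz).1) fun z hz => (hAO' hz).1⟩, hxA, y, ⟨hy.1, hyA'⟩, hyx⟩
    rw [heq]
    exact ((hS.isLocallyClosed.inter (hB.isOpen hU).isLocallyClosed).inter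
      hopen.isClosed_compl.isLocallyClosed).isSigmaCompact
  choose! K hK hKE using hE
  refine ⟨⋃ U ∈ B, range (K U), (TopologicalSpace.countable_countableBasis Y).biUnion
    fun U _ => countable_range _, ?_, fun x hx => ?_⟩
  · intro L hL
    simp only [mem_iUnion] at hL
    obtain ⟨U, hU, n, rfl⟩ := hL
    refine ⟨hK U hU n, fun x hx y hy hxy => ?_⟩
    have hx' : x ∈ E U := hKE U hU ▸ mem_iUnion.2 ⟨n, hx⟩
    have hy' : y ∈ E U := hKE U hU ▸ mem_iUnion.2 ⟨n, hy⟩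
    exact hy'.2 x hx'.1 hxy
  · have hfin : ({x' ∈ S | Φ.orbitMk x' = Φ.orbitMk x} \ {x}).Finite :=
      (hS.finite_fiber x).subset sdiff_subset
    obtain ⟨U, hU, hxU, hUs⟩ := hB.exists_subset_of_mem_open
      (show x ∈ ({x' ∈ S | Φ.orbitMk x' = Φ.orbitMk x} \ {x})ᶜ from fun h => h.2 rfl)
      hfin.isClosed.isOpen_compl
    have hxE : x ∈ E U := ⟨⟨hx, hxU⟩, fun y hy hyx => by
      by_contra hne
      exact hUs hy.2 ⟨⟨hy.1, hyx⟩, hne⟩⟩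
    rw [← hKE U hU] at hxE
    obtain ⟨n, hn⟩ := mem_iUnion.1 hxE
    exact ⟨K U n, mem_biUnion hU (mem_range_self n), hn⟩

variable [ContinuousConstSMul G Y] [ProperlyDiscontinuousSMul G Y]

/-- If periods are locally bounded and there are slices everywhere, the covering dimension of the
orbit space is at most that of the compact subsets of `Y`. -/
theorem LocallyBoundedPeriods.exists_refinement_orbitSpace {Φ : EquivariantFlow G Y}
    (hΦ : Φ.LocallyBoundedPeriods) {d : ℕ∞} (hd : ∀ K : Set Y, IsCompact K → DimLEOn d K)
    (hS : ∀ y, ∃ S, y ∈ S ∧ Φ.IsSlice S)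
    {U : Quotient Φ.orbitSetoid → Set (Quotient Φ.orbitSetoid)} (hU : ∀ w, U w ∈ 𝓝 w) :
    ∃ V : ℕ → Set (Quotient Φ.orbitSetoid), (∀ j, IsOpen (V j)) ∧ (⋃ j, V j = univ) ∧
      (∀ j, (V j).Nonempty → ∃ w, V j ⊆ U w) ∧
      ∀ w, ∀ s : Finset ℕ, (∀ j ∈ s, w ∈ V j) → (s.card : ℕ∞) ≤ d + 1 := by
  have hq := Φ.isOpenQuotientMap_orbitMk
  have : T2Space (Quotient Φ.orbitSetoid) := hΦ.t2Space
  have : LocallyCompactSpace (Quotient Φ.orbitSetoid) := hq.locallyCompactSpace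
  have : SecondCountableTopology (Quotient Φ.orbitSetoid) :=
    hq.isQuotientMap.secondCountableTopology hq.isOpenMap
  let := TopologicalSpace.metrizableSpaceMetric (Quotient Φ.orbitSetoid)
  choose S hyS hS using hS
  choose 𝒦 h𝒦c h𝒦 hS𝒦 using fun y => (hS y).exists_countable_isCompact_injOn
  obtain ⟨T, hTc, hT⟩ := TopologicalSpace.countable_cover_nhds
    (f := fun w : Quotient Φ.orbitSetoid => Φ.orbitMk '' S w.out) (by
      intro w
      refine IsOpen.mem_nhds ?_ ⟨_, hyS w.out, Quotient.out_eq w⟩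
      simpa using (hS w.out).isOpen_image univ isOpen_univ)
  let 𝒞 : Set (Set Y) := insert ∅ (⋃ w ∈ T, 𝒦 (Quotient.out w))
  have h𝒞c : 𝒞.Countable := (hTc.biUnion fun w _ => h𝒦c w.out).insert ∅
  obtain ⟨C, hC⟩ := h𝒞c.exists_eq_range ⟨∅, mem_insert _ _⟩
  have hCprop : ∀ n, IsCompact (C n) ∧ InjOn Φ.orbitMk (C n) := by
    intro n
    have hn : C n ∈ 𝒞 := hC ▸ mem_range_self n
    rcases hn with h | h
    · rw [h]; exact ⟨isCompact_empty, injOn_empty _⟩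
    · simp only [mem_iUnion] at h
      obtain ⟨w, -, hw⟩ := h
      exact h𝒦 _ _ hw
  refine exists_refinement_of_iUnion_dimLEOn (C := fun n => Φ.orbitMk '' C n)
    (fun n => ((hCprop n).1.image hq.continuous).isClosed)
    (fun n => (hd _ (hCprop n).1).image (hCprop n).1 hq.continuous (hCprop n).2) ?_ hU
  refine eq_univ_of_forall fun w => ?_
  obtain ⟨v, hv, x, hx, rfl⟩ := mem_iUnion₂.1 (hT.symm.subset (mem_univ w))
  obtain ⟨K, hK, hxK⟩ := hS𝒦 _ hx
  obtain ⟨n, rfl⟩ : K ∈ range C := hC ▸ mem_insert_of_mem _ (mem_biUnion hv hK)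
  exact mem_iUnion.2 ⟨n, x, hxK, rfl⟩

/-- If periods are locally bounded and there are slices everywhere, there is a `G`-invariant
collection of open `ℱ`-subsets, `ℱ` the family of finite subgroups, such that its dimension is at
most `d` and every flow line lies in one of its members. It is pulled back from the orbit space. -/
theorem LocallyBoundedPeriods.exists_cover {Φ : EquivariantFlow G Y}
    (hΦ : Φ.LocallyBoundedPeriods) {d : ℕ∞} (hd : ∀ K : Set Y, IsCompact K → DimLEOn d K)
    (hS : ∀ y, ∃ S, y ∈ S ∧ Φ.IsSlice S) :
    ∃ 𝒱 : Set (Set Y), (∀ (g : G), ∀ V ∈ 𝒱, g • V ∈ 𝒱) ∧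
      (∀ V ∈ 𝒱, IsOpen V ∧ IsFamilySubset (finSubgroups G) V) ∧
      collectionDim 𝒱 ≤ d ∧ ∀ x, ∃ V ∈ 𝒱, Φ.toFlow.orbit x ⊆ V := by
  have hq := Φ.isOpenQuotientMap_orbitMk
  choose N hNo hyN hNflow hNfam hNfin using hΦ.exists_isFamilySubset
  obtain ⟨V, hVo, hVc, hVN, hord⟩ := hΦ.exists_refinement_orbitSpace hd hS
    (U := fun w => Φ.orbitMk '' N w.out) fun w =>
      (hq.isOpenMap _ (hNo w.out)).mem_nhds ⟨_, hyN w.out, Quotient.out_eq w⟩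
  rcases isEmpty_or_nonempty Y with hY | ⟨⟨y₀⟩⟩
  · refine ⟨∅, by simp, by simp, ?_, fun x => hY.elim x⟩
    exact collectionDim_le_iff.2 fun s hs _ => by
      simp [Finset.coe_eq_empty.1 (subset_empty_iff.1 hs)]
  have : Nonempty (Quotient Φ.orbitSetoid) := ⟨Φ.orbitMk y₀⟩
  choose! c hc using hVN
  let A : ℕ → Set Y := fun j => N (c j).out ∩ Φ.orbitMk ⁻¹' V j
  have hVsmul : ∀ (g : G) (j : ℕ), g • Φ.orbitMk ⁻¹' V j = Φ.orbitMk ⁻¹' V j := fun g j => by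
    ext x
    rw [mem_smul_set_iff_inv_smul_mem, mem_preimage, mem_preimage, orbitMk_smul]
  have hAfam : ∀ j, (V j).Nonempty → IsFamilySubset (finSubgroups G) (A j) := by
    intro j hj
    have hA1 : ∀ g : G, (g • A j ∩ A j).Nonempty → g • N (c j).out = N (c j).out := fun g hg =>
      hNfam _ g (hg.mono (inter_subset_inter (smul_set_mono inter_subset_left) inter_subset_left))
    refine ⟨fun g hg => ?_, ?_⟩
    · change g • (N (c j).out ∩ Φ.orbitMk ⁻¹' V j) = _
      rw [smul_set_inter, hA1 g hg, hVsmul]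
    · obtain ⟨w, hw⟩ := hj
      obtain ⟨x, hx, hxw⟩ := hc j ⟨w, hw⟩ hw
      have hxA : x ∈ A j := ⟨hx, show Φ.orbitMk x ∈ V j by rwa [hxw]⟩
      refine ((hNfin (c j).out).subset fun g hg => hA1 g ⟨x, ?_⟩).to_subtype
      have hg' : g • A j = A j := hg
      rw [hg']
      exact ⟨hxA, hxA⟩
  refine ⟨{B | ∃ (g : G) (j : ℕ), (V j).Nonempty ∧ B = g • A j}, ?_, ?_, ?_, ?_⟩
  · rintro g _ ⟨h, j, hj, rfl⟩
    exact ⟨g * h, j, hj, (mul_smul g h (A j)).symm⟩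
  · rintro _ ⟨g, j, hj, rfl⟩
    exact ⟨((hNo _).inter ((hVo j).preimage hq.continuous)).smul g,
      (hAfam j hj).smul_finSubgroups g⟩
  · classical
    rw [collectionDim_le_iff]
    rintro s hs ⟨x, hx⟩
    have hs' : ∀ B ∈ s, ∃ (g : G) (j : ℕ), (V j).Nonempty ∧ B = g • A j := fun B hB => hs hB
    choose! g j hj hB using hs'
    have hxB : ∀ B ∈ s, x ∈ g B • A (j B) := fun B hB' => hB B hB' ▸ hx B hB'
    -- Different translates of the same `A j` are disjoint, so at most one of them contains `x`.
    have hinj : InjOn j s := by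
      intro B hB₁ B' hB₂ hjj
      have h1 := hxB B hB₁
      have h2 := hxB B' hB₂
      rw [← hjj, mem_smul_set_iff_inv_smul_mem] at h2
      have h3 := (hAfam (j B) (hj B hB₁)).1 ((g B')⁻¹ * g B) ⟨(g B')⁻¹ • x, by
        rw [mul_smul]; exact smul_mem_smul_set h1, h2⟩
      rw [mul_smul, inv_smul_eq_iff] at h3
      rw [hB B hB₁, hB B' hB₂, ← hjj, h3]
    rw [← Finset.card_image_of_injOn hinj]
    refine hord (Φ.orbitMk x) _ fun k hk => ?_
    obtain ⟨B, hB', rfl⟩ := Finset.mem_image.1 hk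
    have := mem_smul_set_iff_inv_smul_mem.1 (hxB B hB')
    simpa [orbitMk_smul] using this.2
  · intro x
    obtain ⟨j, hj⟩ := mem_iUnion.1 (hVc.symm.subset (mem_univ (Φ.orbitMk x)))
    obtain ⟨a, ha, hax⟩ := hc j ⟨_, hj⟩ hj
    obtain ⟨g, t, rfl⟩ := Φ.orbitMk_eq_iff.1 hax
    refine ⟨_, ⟨g, j, ⟨_, hj⟩, rfl⟩, ?_⟩
    rintro _ ⟨s, rfl⟩
    change Φ.toFlow s (g • Φ.toFlow t a) ∈ _
    rw [map_smul]
    refine smul_mem_smul_set ⟨hNflow _ _ _ (hNflow _ _ _ ha), ?_⟩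
    rw [mem_preimage, orbitMk_flow]
    rwa [orbitMk_smul] at hj

end EquivariantFlow

/-! ### Existence of slices -/

namespace EquivariantFlow

section Slices

variable {G Y : Type*} [Group G] [TopologicalSpace Y] [MulAction G Y]

theorem exists_flow_mem_of_isOpen (Φ : EquivariantFlow G Y) {O : Set Y} (hO : IsOpen O) {x : Y}
    (hx : x ∈ O) : ∃ ε > 0, ∃ M, IsOpen M ∧ x ∈ M ∧ ∀ z ∈ M, ∀ t ∈ Icc (-ε) ε,
      Φ.toFlow t z ∈ O := by
  have h : (fun p : ℝ × Y => Φ.toFlow p.1 p.2) ⁻¹' O ∈ 𝓝 ((0 : ℝ), x) :=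
    (hO.preimage Φ.toFlow.cont').mem_nhds (by simpa using hx)
  rw [nhds_prod_eq, mem_prod_iff] at h
  obtain ⟨I, hI, N, hN, hIN⟩ := h
  obtain ⟨ε, hε, hεI⟩ := Metric.nhds_basis_closedBall.mem_iff.1 hI
  obtain ⟨M, hMN, hM, hxM⟩ := mem_nhds_iff.1 hN
  refine ⟨ε, hε, M, hM, hxM, fun z hz t ht => hIN (mk_mem_prod (hεI ?_) (hMN hz))⟩
  rw [Real.closedBall_eq_Icc]
  simpa using ht

theorem LocallyBoundedPeriods.finite_fiber [ProperlyDiscontinuousSMul G Y]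
    {Φ : EquivariantFlow G Y} (hΦ : Φ.LocallyBoundedPeriods) {S K : Set Y} (hK : IsCompact K)
    (hSK : S ⊆ K) (hS : ∀ x P, {z ∈ S | ∃ t ∈ Icc 0 P, Φ.toFlow t x = z}.Finite) (y : Y) :
    {x ∈ S | Φ.orbitMk x = Φ.orbitMk y}.Finite := by
  rcases {x ∈ S | Φ.orbitMk x = Φ.orbitMk y}.eq_empty_or_nonempty with h | ⟨z₀, hz₀, hzy⟩
  · rw [h]; exact finite_empty
  choose P hP using hΦ
  refine ((LocallyBoundedPeriods.finite_setOf_smul_flow_mem (fun x => ⟨P x, hP x⟩) hK hK).biUnion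
    fun g _ => hS (g • z₀) (P (g • z₀))).subset ?_
  rintro z ⟨hz, hzy'⟩
  obtain ⟨g, t, rfl⟩ := Φ.orbitMk_eq_iff.1 (hzy.trans hzy'.symm)
  refine mem_biUnion (show g ∈ _ from ⟨z₀, hSK hz₀, t, hSK hz⟩) ⟨hz, ?_⟩
  rw [← map_smul]
  exact Φ.exists_mem_Icc_flow_eq (hP (g • z₀)).self_of_nhds t

variable [ContinuousConstSMul G Y] [ProperlyDiscontinuousSMul G Y]

/-- Relatively compact open sets are slices for the trivial flow. -/
theorem exists_isSlice_of_forall_flow_eq [LocallyCompactSpace Y] {Φ : EquivariantFlow G Y}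
    (h : ∀ t y, Φ.toFlow t y = y) (y : Y) : ∃ S, y ∈ S ∧ Φ.IsSlice S := by
  obtain ⟨K, hK, hyK⟩ := exists_compact_mem_nhds y
  refine ⟨interior K, mem_interior_iff_mem_nhds.2 hyK, isOpen_interior.isLocallyClosed,
    fun N hN => Φ.isOpenQuotientMap_orbitMk.isOpenMap _ (isOpen_interior.inter hN),
    LocallyBoundedPeriods.finite_fiber (fun x => ⟨1, .of_forall fun z =>
      ⟨1, one_pos, le_rfl, h 1 z⟩⟩) hK interior_subset fun x P => (finite_singleton x).subset ?_⟩
  rintro z ⟨-, t, -, rfl⟩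
  exact h t x

/-- A continuous function that increases along the flow near `x` has a level set that is a slice
through `x`. -/
theorem LocallyBoundedPeriods.exists_isSlice_of_increasing [LocallyCompactSpace Y] [T2Space Y]
    {Φ : EquivariantFlow G Y} (hΦ : Φ.LocallyBoundedPeriods) {x : Y} {θ : Y → ℝ}
    (hθ : Continuous θ) {O : Set Y} (hO : IsOpen O) (hx : x ∈ O)
    (hinc : ∀ z t, 0 < t → (∀ r ∈ Icc 0 t, Φ.toFlow r z ∈ O) → θ z < θ (Φ.toFlow t z)) :
    ∃ S, x ∈ S ∧ Φ.IsSlice S := by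
  obtain ⟨K, hK, hxK⟩ := exists_compact_mem_nhds x
  obtain ⟨ε, hε, M, hM, hxM, hMO⟩ := Φ.exists_flow_mem_of_isOpen hO hx
  refine ⟨(M ∩ interior K) ∩ {z | θ z = θ x}, ⟨⟨hxM, mem_interior_iff_mem_nhds.2 hxK⟩, rfl⟩,
    ((hM.inter isOpen_interior).isLocallyClosed).inter
      (isClosed_eq hθ continuous_const).isLocallyClosed, fun N hN => ?_,
    hΦ.finite_fiber hK (fun z hz => interior_subset hz.1.2) fun y P => ?_⟩
  · rw [isOpen_iff_mem_nhds]
    rintro _ ⟨y, ⟨⟨hyMK, hyθ⟩, hyN⟩, rfl⟩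
    obtain ⟨δ₀, hδ₀, M', hM', hyM', hM'O⟩ := Φ.exists_flow_mem_of_isOpen
      ((hM.inter isOpen_interior).inter hN) ⟨hyMK, hyN⟩
    set δ := min δ₀ ε
    have hδ : 0 < δ := lt_min hδ₀ hε
    have hδε : δ ≤ ε := min_le_right _ _
    have hδδ : δ ≤ δ₀ := min_le_left _ _
    have hhi : θ x < θ (Φ.toFlow δ y) := by
      rw [← hyθ]
      exact hinc y δ hδ fun r hr => hMO y hyMK.1 r ⟨by linarith [hr.1], hr.2.trans hδε⟩
    have hlo : θ (Φ.toFlow (-δ) y) < θ x := by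
      have := hinc (Φ.toFlow (-δ) y) δ hδ fun r hr => by
        rw [← Flow.map_add]
        exact hMO y hyMK.1 _ ⟨by linarith [hr.1], by linarith [hr.2]⟩
      rwa [← Flow.map_add, add_neg_cancel, Flow.map_zero_apply, hyθ] at this
    have hopen : IsOpen (M' ∩ ({z | θ x < θ (Φ.toFlow δ z)} ∩ {z | θ (Φ.toFlow (-δ) z) < θ x})) :=
      hM'.inter ((isOpen_lt continuous_const (hθ.comp (Φ.toFlow.continuous_toFun δ))).inter
        (isOpen_lt (hθ.comp (Φ.toFlow.continuous_toFun (-δ))) continuous_const))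
    refine mem_of_superset ((Φ.isOpenQuotientMap_orbitMk.isOpenMap _ hopen).mem_nhds
      ⟨y, ⟨hyM', hhi, hlo⟩, rfl⟩) ?_
    rintro _ ⟨z, ⟨hz, hzhi, hzlo⟩, rfl⟩
    have hcont : Continuous fun s => θ (Φ.toFlow s z) :=
      hθ.comp (Φ.toFlow.cont'.comp (continuous_id.prodMk continuous_const))
    obtain ⟨s, hs, hsz⟩ := intermediate_value_Icc (by linarith : -δ ≤ δ) hcont.continuousOn
      ⟨hzlo.le, hzhi.le⟩
    have := hM'O z hz s ⟨by linarith [hs.1], hs.2.trans hδδ⟩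
    exact ⟨_, ⟨⟨this.1, hsz⟩, this.2⟩, Φ.orbitMk_flow s z⟩
  · -- Two times at which the same flow line meets the level set differ by at least `ε`.
    have hsep : ∀ t t', Φ.toFlow t y ∈ (M ∩ interior K) ∩ {z | θ z = θ x} →
        Φ.toFlow t' y ∈ (M ∩ interior K) ∩ {z | θ z = θ x} → t < t' → ε ≤ t' - t := by
      intro t t' ht ht' htt
      by_contra! hlt
      have := hinc (Φ.toFlow t y) (t' - t) (by linarith) fun r hr =>
        hMO _ ht.1.1 r ⟨by linarith [hr.1], by linarith [hr.2]⟩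
      rw [← Flow.map_add, sub_add_cancel] at this
      exact this.ne (ht.2.trans ht'.2.symm)
    have hfin : {t ∈ Icc 0 P | Φ.toFlow t y ∈ (M ∩ interior K) ∩ {z | θ z = θ x}}.Finite := by
      refine Set.Finite.of_injOn (f := fun t : ℝ => ⌊t / ε⌋) (t := Icc 0 ⌊P / ε⌋) ?_ ?_
        (finite_Icc _ _)
      · rintro t ⟨ht, -⟩
        exact ⟨Int.floor_nonneg.2 (div_nonneg ht.1 hε.le),
          Int.floor_mono (div_le_div_of_nonneg_right ht.2 hε.le)⟩
      · rintro t ⟨-, ht⟩ t' ⟨-, ht'⟩ htt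
        have habs := Int.abs_sub_lt_one_of_floor_eq_floor htt
        rw [← sub_div, abs_div, abs_of_pos hε, div_lt_one hε, abs_lt] at habs
        rcases lt_trichotomy t t' with h | h | h
        · linarith [hsep t t' ht ht' h]
        · exact h
        · linarith [hsep t' t ht' ht h]
    refine (hfin.image fun t => Φ.toFlow t y).subset ?_
    rintro z ⟨hz, t, ht, rfl⟩
    exact ⟨t, ⟨ht, hz⟩, rfl⟩

end Slices

section Metric

variable {G Y : Type*} [Group G] [MetricSpace Y] [MulAction G Y]

/-- If `Φ_τ x ≠ x`, then `z ↦ ∫₀^τ d(Φ_s z, x) ds` increases along the flow near `x`, since its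
derivative along the flow is `d(Φ_τ z, x) - d(z, x)`. -/
theorem exists_increasing (Φ : EquivariantFlow G Y) {x : Y} {τ : ℝ} (hτ : Φ.toFlow τ x ≠ x) :
    ∃ (θ : Y → ℝ) (O : Set Y), Continuous θ ∧ IsOpen O ∧ x ∈ O ∧
      ∀ z t, 0 < t → (∀ r ∈ Icc 0 t, Φ.toFlow r z ∈ O) → θ z < θ (Φ.toFlow t z) := by
  have hf : Continuous fun p : Y × ℝ => dist (Φ.toFlow p.2 p.1) x :=
    (Φ.toFlow.cont'.comp continuous_swap).dist continuous_const
  refine ⟨fun z => ∫ s in (0)..τ, dist (Φ.toFlow s z) x,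
    {z | dist z x < dist (Φ.toFlow τ z) x}, ?_, ?_, by simpa using hτ, fun z t ht hz => ?_⟩
  · exact intervalIntegral.continuous_parametric_intervalIntegral_of_continuous' hf 0 τ
  · exact isOpen_lt (continuous_id.dist continuous_const)
      ((Φ.toFlow.continuous_toFun τ).dist continuous_const)
  · have hF : Continuous fun s => dist (Φ.toFlow s z) x :=
      hf.comp (continuous_const.prodMk continuous_id)
    have hint : ∀ a b,
        IntervalIntegrable (fun s => dist (Φ.toFlow s z) x) MeasureTheory.volume a b :=
      fun a b => hF.intervalIntegrable a b
    have hτF : Continuous fun s => dist (Φ.toFlow (s + τ) z) x :=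
      hF.comp (continuous_id.add continuous_const)
    have h1 : ∫ s in (0)..τ, dist (Φ.toFlow s (Φ.toFlow t z)) x =
        ∫ s in t..(τ + t), dist (Φ.toFlow s z) x := by
      simp_rw [← Flow.map_add]
      rw [intervalIntegral.integral_comp_add_right (fun s => dist (Φ.toFlow s z) x) t, zero_add]
    have h2 : ∫ s in (0)..t, dist (Φ.toFlow (s + τ) z) x =
        ∫ s in τ..(τ + t), dist (Φ.toFlow s z) x := by
      rw [intervalIntegral.integral_comp_add_right (fun s => dist (Φ.toFlow s z) x) τ, zero_add,
        add_comm]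
    have h3 : 0 < ∫ s in (0)..t, (dist (Φ.toFlow (s + τ) z) x - dist (Φ.toFlow s z) x) := by
      refine intervalIntegral.intervalIntegral_pos_of_pos_on
        ((hτF.sub hF).intervalIntegrable 0 t) (fun s hs => ?_) ht
      have := hz s ⟨hs.1.le, hs.2.le⟩
      rw [mem_ofPred_eq, ← Flow.map_add, add_comm τ] at this
      linarith
    rw [intervalIntegral.integral_sub (hτF.intervalIntegrable 0 t) (hint 0 t), h2] at h3
    beta_reduce
    rw [h1]
    have h4 := intervalIntegral.integral_add_adjacent_intervals (hint 0 t) (hint t (τ + t))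
    have h5 := intervalIntegral.integral_add_adjacent_intervals (hint 0 τ) (hint τ (τ + t))
    linarith

end Metric

end EquivariantFlow

/-! ### Points returning to their orbit under elements of finite order -/

namespace EquivariantFlow

variable {G X : Type*} [Group G] [TopologicalSpace X] [MulAction G X]

/-- The points that return to their own `G`-orbit within time `c`, up to an element of `G` of finite
order. -/
def finOrderReturn (Φ : EquivariantFlow G X) (c : ℝ) : Set X :=
  {x | ∃ t, 0 < t ∧ t ≤ c ∧ ∃ g : G, IsOfFinOrder g ∧ Φ.toFlow t x = g • x}

theorem flow_nat_mul (Φ : EquivariantFlow G X) {t : ℝ} {g : G} {x : X}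
    (h : Φ.toFlow t x = g • x) (n : ℕ) : Φ.toFlow (n * t) x = g ^ n • x := by
  induction n with
  | zero => simp
  | succ n ih =>
    rw [Nat.cast_succ, add_mul, one_mul, Flow.map_add, h, map_smul, ih, pow_succ', mul_smul]

theorem flow_orderOf_mul (Φ : EquivariantFlow G X) {t : ℝ} {g : G} {x : X}
    (h : Φ.toFlow t x = g • x) : Φ.toFlow (orderOf g * t) x = x := by
  rw [Φ.flow_nat_mul h, pow_orderOf_eq_one, one_smul]

theorem flow_mem_finOrderReturn (Φ : EquivariantFlow G X) {c : ℝ} {x : X}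
    (h : x ∈ Φ.finOrderReturn c) (s : ℝ) : Φ.toFlow s x ∈ Φ.finOrderReturn c := by
  obtain ⟨t, ht, htc, g, hg, hx⟩ := h
  refine ⟨t, ht, htc, g, hg, ?_⟩
  rw [← Flow.map_add, add_comm, Flow.map_add, hx, map_smul]

theorem smul_mem_finOrderReturn (Φ : EquivariantFlow G X) {c : ℝ} {x : X}
    (h : x ∈ Φ.finOrderReturn c) (k : G) : k • x ∈ Φ.finOrderReturn c := by
  obtain ⟨t, ht, htc, g, hg, hx⟩ := h
  refine ⟨t, ht, htc, k * g * k⁻¹, (MulAut.conj k).toMonoidHom.isOfFinOrder hg, ?_⟩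
  rw [map_smul, hx, mul_smul, mul_smul, inv_smul_smul]

/-- An element of `G` along which a periodic flow line returns has finite order, since its powers
move a compact set only finitely often into itself. -/
theorem isOfFinOrder_of_flow_eq [ProperlyDiscontinuousSMul G X] (Φ : EquivariantFlow G X) {p t : ℝ}
    {g : G} {x : X} (hp : 0 < p) (hpx : Φ.toFlow p x = x) (h : Φ.toFlow t x = g • x) :
    IsOfFinOrder g := by
  have hK : IsCompact ((fun s => Φ.toFlow s x) '' Icc 0 p) :=
    isCompact_Icc.image (Φ.toFlow.cont'.comp (continuous_id.prodMk continuous_const))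
  have hmem : ∀ r, Φ.toFlow r x ∈ (fun s => Φ.toFlow s x) '' Icc 0 p := fun r =>
    Φ.exists_mem_Icc_flow_eq ⟨p, hp, le_rfl, hpx⟩ r
  rw [← finite_powers]
  refine (ProperlyDiscontinuousSMul.finite_disjoint_inter_image (Γ := G) hK hK).subset ?_
  rintro _ ⟨n, rfl⟩
  refine ⟨_, ⟨_, hmem 0, rfl⟩, ?_⟩
  change g ^ n • Φ.toFlow 0 x ∈ _
  rw [Flow.map_zero_apply, ← Φ.flow_nat_mul h]
  exact hmem _

theorem mem_cyc_iff [ProperlyDiscontinuousSMul G X] (Φ : EquivariantFlow G X) {γ : ℝ} {x : X} :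
    x ∈ Φ.cyc γ ↔ ∀ c, γ < c → x ∈ Φ.finOrderReturn c := by
  have hquot : ∀ t : ℝ, Φ.quotientFlow t (Quotient.mk (MulAction.orbitRel G X) x) =
      Quotient.mk (MulAction.orbitRel G X) x ↔ ∃ g : G, Φ.toFlow t x = g • x := by
    intro t
    change Quotient.mk (MulAction.orbitRel G X) (Φ.toFlow t x) = _ ↔ _
    rw [Quotient.eq, MulAction.orbitRel_apply]
    exact exists_congr fun g => eq_comm
  constructor
  · rintro ⟨⟨p, hp, hpx⟩, hγ⟩ c hc
    have hlt : Φ.gPeriod x < (c : EReal) := lt_of_le_of_lt hγ (EReal.coe_lt_coe_iff.2 hc)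
    obtain ⟨_, ⟨t, ⟨ht, htx⟩, rfl⟩, htc⟩ := sInf_lt_iff.1 hlt
    obtain ⟨g, hg⟩ := (hquot t).1 htx
    exact ⟨t, ht, (EReal.coe_lt_coe_iff.1 htc).le, g, Φ.isOfFinOrder_of_flow_eq hp hpx hg, hg⟩
  · intro h
    constructor
    · obtain ⟨t, ht, -, g, hg, hx⟩ := h (γ + 1) (by linarith)
      have : (0 : ℝ) < orderOf g := by exact_mod_cast hg.orderOf_pos
      exact ⟨orderOf g * t, by positivity, Φ.flow_orderOf_mul hx⟩
    · refine EReal.le_of_forall_lt_iff_le.1 fun c hc => ?_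
      obtain ⟨t, ht, htc, g, -, hx⟩ := h c (EReal.coe_lt_coe_iff.1 hc)
      have hle : Φ.gPeriod x ≤ (t : EReal) :=
        sInf_le (mem_image_of_mem _ ⟨ht, (hquot t).2 ⟨g, hx⟩⟩)
      exact hle.trans (EReal.coe_le_coe_iff.2 htc)

/-- Near a given point, the elements of `G` occurring in the definition of `Φ.finOrderReturn c`
belong to a finite set. -/
theorem exists_finite_return [ProperlyDiscontinuousSMul G X] [LocallyCompactSpace X]
    (Φ : EquivariantFlow G X) (c : ℝ) (x : X) : ∃ T : Set G, T.Finite ∧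
      ∀ᶠ y in 𝓝 x, ∀ t ∈ Icc 0 c, ∀ g : G, Φ.toFlow t y = g • y → g ∈ T := by
  obtain ⟨K, hK, hxK⟩ := exists_compact_mem_nhds x
  refine ⟨_, ProperlyDiscontinuousSMul.finite_disjoint_inter_image (Γ := G) hK
    (((isCompact_Icc (a := (0 : ℝ)) (b := c)).prod hK).image Φ.toFlow.cont'), ?_⟩
  filter_upwards [hxK] with y hy t ht g hg
  exact ⟨_, ⟨y, hy, rfl⟩, (t, y), ⟨ht, hy⟩, hg⟩

theorem eventually_finOrderReturn_period_le [ProperlyDiscontinuousSMul G X] [LocallyCompactSpace X]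
    (Φ : EquivariantFlow G X) (c : ℝ) (x : X) :
    ∃ P : ℝ, ∀ᶠ y in 𝓝 x, y ∈ Φ.finOrderReturn c → ∃ p, 0 < p ∧ p ≤ P ∧ Φ.toFlow p y = y := by
  obtain ⟨T, hT, hev⟩ := Φ.exists_finite_return c x
  refine ⟨(∑ g ∈ hT.toFinset, orderOf g : ℕ) * c, ?_⟩
  filter_upwards [hev] with y hy
  rintro ⟨t, ht, htc, g, hg, hgy⟩
  have hgT : g ∈ hT.toFinset := hT.mem_toFinset.2 (hy t ⟨ht.le, htc⟩ g hgy)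
  have hpos : (0 : ℝ) < orderOf g := by exact_mod_cast hg.orderOf_pos
  refine ⟨orderOf g * t, by positivity, ?_, Φ.flow_orderOf_mul hgy⟩
  have hle : orderOf g ≤ ∑ g ∈ hT.toFinset, orderOf g :=
    Finset.single_le_sum (f := fun g : G => orderOf g) (fun _ _ => Nat.zero_le _) hgT
  have : (orderOf g : ℝ) ≤ (∑ g ∈ hT.toFinset, orderOf g : ℕ) := by exact_mod_cast hle
  gcongr

/-- A limit of periodic points whose periods tend to `0` is a fixed point of the flow. -/
theorem flow_eq_of_tendsto_period [T2Space X] (Φ : EquivariantFlow G X) {x : X} {l : Filter X}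
    [l.NeBot] (hl : l ≤ 𝓝 x) {s : X → ℝ} (hs : Tendsto s l (𝓝 0))
    (hper : ∀ᶠ y in l, 0 < s y ∧ Φ.toFlow (s y) y = y) (r : ℝ) : Φ.toFlow r x = x := by
  -- The largest multiple of the period of `y` that does not exceed `r` tends to `r`.
  have hk : Tendsto (fun y => (⌊r / s y⌋ : ℝ) * s y) l (𝓝 r) := by
    have h0 : Tendsto (fun y => r - (⌊r / s y⌋ : ℝ) * s y) l (𝓝 0) := by
      refine tendsto_of_tendsto_of_tendsto_of_le_of_le' tendsto_const_nhds hs ?_ ?_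
      · exact hper.mono fun y hy => Int.sub_floor_div_mul_nonneg r hy.1
      · exact hper.mono fun y hy => (Int.sub_floor_div_mul_lt r hy.1).le
    simpa using (tendsto_const_nhds (x := r)).sub h0
  have hid : Tendsto (fun y : X => y) l (𝓝 x) := hl
  refine tendsto_nhds_unique ((Φ.toFlow.cont'.tendsto (r, x)).comp (hk.prodMk_nhds hid)) ?_
  refine hid.congr' (hper.mono fun y hy => ?_)
  have := (Φ.periodic hy.2).int_mul_eq ⌊r / s y⌋
  simpa using this.symm

/-- The set `Φ.finOrderReturn c` is closed away from the fixed points of the flow. -/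
theorem mem_finOrderReturn_of_mem_closure [ProperlyDiscontinuousSMul G X] [LocallyCompactSpace X]
    [T2Space X] [ContinuousConstSMul G X] (Φ : EquivariantFlow G X) {c : ℝ} {x : X}
    (hx : x ∈ closure (Φ.finOrderReturn c)) (hfix : ¬ ∀ r, Φ.toFlow r x = x) :
    x ∈ Φ.finOrderReturn c := by
  obtain ⟨u, hu, hux⟩ := mem_closure_iff_ultrafilter.1 hx
  have hu' : ∀ᶠ y in (u : Filter X), ∃ t, 0 < t ∧ t ≤ c ∧ ∃ g : G, IsOfFinOrder g ∧
    Φ.toFlow t y = g • y := hu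
  obtain ⟨T, hT, hev⟩ := Φ.exists_finite_return c x
  choose! t ht htc g hg hgy using fun (y : X) (h : ∃ t, 0 < t ∧ t ≤ c ∧ ∃ g : G, IsOfFinOrder g ∧
    Φ.toFlow t y = g • y) => h
  obtain ⟨k, -, hk⟩ := (Ultrafilter.eventually_exists_mem_iff (P := fun k y => g y = k) hT).1 (by
    filter_upwards [hux hev, hu'] with y hy hy'
    exact ⟨g y, hy (t y) ⟨(ht y hy').le, htc y hy'⟩ (g y) (hgy y hy'), rfl⟩)
  obtain ⟨τ, hτ, htτ⟩ := (isCompact_Icc (a := (0 : ℝ)) (b := c)).ultrafilter_le_nhds (u.map t) (by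
    rw [le_principal_iff]
    exact hu'.mono fun y hy => ⟨(ht y hy).le, htc y hy⟩)
  have htτ' : Tendsto t u (𝓝 τ) := htτ
  have hid : Tendsto (fun y : X => y) (u : Filter X) (𝓝 x) := hux
  have hkfin : IsOfFinOrder k := by
    obtain ⟨y, hy, hyk⟩ := (hu'.and hk).exists
    exact hyk ▸ hg y hy
  have hlim : Φ.toFlow τ x = k • x := by
    refine tendsto_nhds_unique ((Φ.toFlow.cont'.tendsto (τ, x)).comp (htτ'.prodMk_nhds hid)) ?_
    refine (hid.const_smul k).congr' ?_
    filter_upwards [hu', hk] with y hy hyk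
    rw [← hyk]
    exact (hgy y hy).symm
  refine ⟨τ, lt_of_le_of_ne hτ.1 fun h0 => hfix ?_, hτ.2, k, hkfin, hlim⟩
  -- If the return times tend to `0`, so do the periods, as `k` has finite order.
  refine Φ.flow_eq_of_tendsto_period hux (s := fun y => orderOf k * t y) ?_ ?_
  · simpa [← h0] using htτ'.const_mul (orderOf k : ℝ)
  · filter_upwards [hu', hk] with y hy hyk
    have hpos : (0 : ℝ) < orderOf k := by exact_mod_cast hkfin.orderOf_pos
    exact ⟨mul_pos hpos (ht y hy), Φ.flow_orderOf_mul (hyk ▸ hgy y hy)⟩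

end EquivariantFlow

/-! ### Restriction to invariant subsets and extension of families -/

namespace EquivariantFlow

variable {G X : Type*} [Group G] [TopologicalSpace X] [MulAction G X]

/-- The restriction of a flow to a subset invariant under `G` and the flow. -/
def restrict (Φ : EquivariantFlow G X) (A : SubMulAction G X)
    (hA : IsInvariant Φ.toFlow (A : Set X)) : EquivariantFlow G A where
  toFlow := Φ.toFlow.restrict hA
  map_smul' t g x := Subtype.ext (Φ.map_smul' t g x)

end EquivariantFlow

namespace SubMulAction

variable {G X : Type*} [Group G] [TopologicalSpace X] [MulAction G X] (A : SubMulAction G X)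

theorem continuousConstSMul [ContinuousConstSMul G X] : ContinuousConstSMul G A :=
  ⟨fun g => (continuous_subtype_val.const_smul g).subtype_mk _⟩

theorem properlyDiscontinuousSMul [ProperlyDiscontinuousSMul G X] :
    ProperlyDiscontinuousSMul G A := by
  refine ⟨fun {K L} hK hL => ?_⟩
  refine (ProperlyDiscontinuousSMul.finite_disjoint_inter_image (Γ := G)
    (hK.image continuous_subtype_val) (hL.image continuous_subtype_val)).subset ?_
  rintro g ⟨_, ⟨x, hx, rfl⟩, hgx⟩
  exact ⟨g • (x : X), ⟨x, ⟨x, hx, rfl⟩, rfl⟩, ⟨_, hgx, rfl⟩⟩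

end SubMulAction

/-- An equivariant way `f` of extending subsets of `A` to subsets of `X`, creating no new
intersections, carries a `G`-invariant family of `ℱ`-subsets of dimension at most `d` to another
one. -/
theorem IsFamilySubset.image_family {G A X : Type*} [Group G] [MulAction G A] [MulAction G X]
    {f : Set A → Set X} (hsmul : ∀ (g : G) V, f (g • V) = g • f V)
    (hinter : ∀ t : Finset (Set A), t.Nonempty → ∀ x, (∀ V ∈ t, x ∈ f V) →
      (⋂₀ (↑t : Set (Set A))).Nonempty) {𝒱 : Set (Set A)} (h𝒱 : ∀ (g : G), ∀ V ∈ 𝒱, g • V ∈ 𝒱)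
    (hinj : InjOn f 𝒱) (hfam : ∀ V ∈ 𝒱, IsFamilySubset (finSubgroups G) V)
    {d : ℕ∞} (hd : collectionDim 𝒱 ≤ d) :
    (∀ (g : G), ∀ V ∈ f '' 𝒱, g • V ∈ f '' 𝒱) ∧
      (∀ V ∈ f '' 𝒱, IsFamilySubset (finSubgroups G) V) ∧ collectionDim (f '' 𝒱) ≤ d := by
  classical
  refine ⟨?_, ?_, ?_⟩
  · rintro g _ ⟨V, hV, rfl⟩
    exact ⟨g • V, h𝒱 g V hV, hsmul g V⟩
  · rintro _ ⟨V, hV, rfl⟩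
    constructor
    · rintro g ⟨x, hgx, hx⟩
      rw [← hsmul] at hgx ⊢
      obtain ⟨a, ha⟩ := hinter {g • V, V} (by simp) x (by simp [hgx, hx])
      rw [(hfam V hV).1 g ⟨a, ha _ (by simp), ha _ (by simp)⟩]
    · have heq : MulAction.stabilizer G (f V) = MulAction.stabilizer G V := by
        ext g
        rw [MulAction.mem_stabilizer_iff, MulAction.mem_stabilizer_iff, ← hsmul,
          hinj.eq_iff (h𝒱 g V hV) hV]
      rw [heq]
      exact (hfam V hV).2
  · rw [collectionDim_le_iff] at hd ⊢
    rintro s hs ⟨x, hx⟩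
    obtain ⟨t, ht, rfl⟩ := Finset.subset_set_image_iff.1 hs
    rcases t.eq_empty_or_nonempty with rfl | hne
    · simp
    refine le_trans (by exact_mod_cast Finset.card_image_le)
      (hd t ht (hinter t hne x fun V hV => ?_))
    exact hx _ (by simpa using ⟨V, hV, rfl⟩)

section Extension

variable {X : Type*} [MetricSpace X]

/-- The points that are closer to `F` than to `F \ V`; if `V` is relatively open in `F`, this is an
open set meeting `F` in `V`. Distances to the empty set are infinite. -/
def metricExtension (F V : Set X) : Set X :=
  {x | Metric.infEDist x F < Metric.infEDist x (F \ V)}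

theorem isOpen_metricExtension (F V : Set X) : IsOpen (metricExtension F V) :=
  isOpen_lt Metric.continuous_infEDist Metric.continuous_infEDist

theorem metricExtension_inter {F V : Set X} (hVF : V ⊆ F) (hV : IsClosed (F \ V)) :
    metricExtension F V ∩ F = V := by
  ext x
  constructor
  · rintro ⟨hx, hxF⟩
    by_contra hxV
    have hlt : Metric.infEDist x F < Metric.infEDist x (F \ V) := hx
    rw [Metric.infEDist_zero_of_mem (show x ∈ F \ V from ⟨hxF, hxV⟩)] at hlt
    exact not_lt_bot hlt
  · intro hx
    refine ⟨?_, hVF hx⟩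
    change Metric.infEDist x F < Metric.infEDist x (F \ V)
    rw [Metric.infEDist_zero_of_mem (hVF hx), pos_iff_ne_zero]
    exact fun h => ((Metric.mem_iff_infEDist_zero_of_closed hV).2 h).2 hx

theorem metricExtension_smul {G : Type*} [Group G] [MulAction G X] [IsIsometricSMul G X] {F : Set X}
    (g : G) (hF : g • F = F) (V : Set X) : metricExtension F (g • V) = g • metricExtension F V := by
  ext x
  rw [mem_smul_set_iff_inv_smul_mem]
  change Metric.infEDist x F < Metric.infEDist x (F \ g • V) ↔
    Metric.infEDist (g⁻¹ • x) F < Metric.infEDist (g⁻¹ • x) (F \ V)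
  rw [← Metric.infEDist_smul g (g⁻¹ • x) F, ← Metric.infEDist_smul g (g⁻¹ • x) (F \ V),
    smul_set_sdiff, hF, smul_inv_smul]

theorem exists_mem_of_mem_metricExtension {F : Set X} {t : Finset (Set X)} (ht : t.Nonempty) {x : X}
    (hx : ∀ V ∈ t, x ∈ metricExtension F V) : ∃ y ∈ F, ∀ V ∈ t, y ∈ V := by
  obtain ⟨W, hW, hmin⟩ := t.exists_min_image (fun V => Metric.infEDist x (F \ V)) ht
  -- A point of `F` almost as close to `x` as possible is too close to lie in any `F \ V`.
  obtain ⟨y, hy, hxy⟩ := Metric.infEDist_lt_iff.1 (hx W hW)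
  refine ⟨y, hy, fun V hV => ?_⟩
  by_contra hyV
  exact absurd ((Metric.infEDist_le_edist_of_mem (show y ∈ F \ V from ⟨hy, hyV⟩)).trans_lt hxy)
    (hmin V hV).not_gt

end Extension

/-! ### Fixed points and nonfixed points -/

namespace EquivariantFlow

variable {G X : Type*} [Group G] [MetricSpace X] [MulAction G X]

/-- On an invariant locally closed subset with locally bounded periods that contains only fixed
points or no fixed points of the flow there are invariant covers whose dimension is at most that
of `X`. -/
theorem exists_cover_of_isLocallyClosed [ContinuousConstSMul G X] [ProperlyDiscontinuousSMul G X]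
    [LocallyCompactSpace X] [SecondCountableTopology X] (Φ : EquivariantFlow G X) {d : ℕ∞}
    (hd : coveringDim X = d) (A : SubMulAction G X) (hA : IsInvariant Φ.toFlow (A : Set X))
    (hclosed : IsLocallyClosed (A : Set X))
    (hper : ∀ x, ∃ P : ℝ, ∀ᶠ y in 𝓝 x, y ∈ A → ∃ p, 0 < p ∧ p ≤ P ∧ Φ.toFlow p y = y)
    (hfix : (∀ x ∈ A, ∀ t, Φ.toFlow t x = x) ∨ ∀ x ∈ A, ¬ ∀ t, Φ.toFlow t x = x) :
    ∃ 𝒱 : Set (Set A), (∀ (g : G), ∀ V ∈ 𝒱, g • V ∈ 𝒱) ∧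
      (∀ V ∈ 𝒱, IsOpen V ∧ IsFamilySubset (finSubgroups G) V) ∧
      collectionDim 𝒱 ≤ d ∧ ∀ x : A, ∃ V ∈ 𝒱, Φ.toFlow.orbit (x : X) ⊆ (↑) '' V := by
  have : LocallyCompactSpace A := hclosed.locallyCompactSpace
  have := A.continuousConstSMul
  have := A.properlyDiscontinuousSMul
  have hbdd : (Φ.restrict A hA).LocallyBoundedPeriods := by
    intro x
    obtain ⟨P, hP⟩ := hper x
    refine ⟨P, (continuous_subtype_val.continuousAt.eventually hP).mono fun y hy => ?_⟩
    obtain ⟨p, h0, h1, h2⟩ := hy y.2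
    exact ⟨p, h0, h1, Subtype.ext h2⟩
  have hslice : ∀ y, ∃ S, y ∈ S ∧ (Φ.restrict A hA).IsSlice S := by
    intro y
    rcases hfix with h | h
    · exact exists_isSlice_of_forall_flow_eq (fun t y => Subtype.ext (h y y.2 t)) y
    · obtain ⟨τ, hτ⟩ := not_forall.1 (h y y.2)
      obtain ⟨θ, O, hθ, hO, hyO, hinc⟩ := (Φ.restrict A hA).exists_increasing (x := y) (τ := τ)
        fun h => hτ (congrArg Subtype.val h)
      exact hbdd.exists_isSlice_of_increasing hθ hO hyO hinc
  obtain ⟨𝒱, h1, h2, h3, h4⟩ := hbdd.exists_cover (d := d) (fun K hK => DimLEOn.of_image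
    IsInducing.subtypeVal (((hK.image continuous_subtype_val).isClosed).dimLEOn hd)) hslice
  refine ⟨𝒱, h1, h2, h3, fun x => ?_⟩
  obtain ⟨V, hV, hxV⟩ := h4 x
  refine ⟨V, hV, ?_⟩
  rintro _ ⟨t, rfl⟩
  exact ⟨(Φ.restrict A hA).toFlow t x, hxV ((Φ.restrict A hA).toFlow.mem_orbit x t), rfl⟩

/-- The fixed points of the flow. -/
def fixedPoints (Φ : EquivariantFlow G X) : SubMulAction G X where
  carrier := {x | ∀ t, Φ.toFlow t x = x}
  smul_mem' g x hx t := by rw [map_smul, hx t]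

theorem isClosed_fixedPoints (Φ : EquivariantFlow G X) : IsClosed (Φ.fixedPoints : Set X) := by
  have : (Φ.fixedPoints : Set X) = ⋂ t, {x | Φ.toFlow t x = x} := by
    ext x
    simp only [mem_iInter]
    rfl
  rw [this]
  exact isClosed_iInter fun t => isClosed_eq (Φ.toFlow.continuous_toFun t) continuous_id

theorem isInvariant_fixedPoints (Φ : EquivariantFlow G X) :
    IsInvariant Φ.toFlow (Φ.fixedPoints : Set X) := fun t x hx => by
  rw [show Φ.toFlow t x = x from hx t]
  exact hx

theorem fixedPoints_subset_cyc [ProperlyDiscontinuousSMul G X] (Φ : EquivariantFlow G X) {γ : ℝ}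
    (hγ : 0 ≤ γ) : (Φ.fixedPoints : Set X) ⊆ Φ.cyc γ := fun x hx =>
  Φ.mem_cyc_iff.2 fun c hc => ⟨c, hγ.trans_lt hc, le_rfl, 1, IsOfFinOrder.one, by
    rw [one_smul]; exact hx c⟩

variable [ProperlyDiscontinuousSMul G X]

/-- The points of `X_cyc` that are not fixed by the flow. -/
def cycNonfixed (Φ : EquivariantFlow G X) (γ : ℝ) : SubMulAction G X where
  carrier := {x | x ∈ Φ.cyc γ ∧ x ∉ Φ.fixedPoints}
  smul_mem' g x hx := by
    refine ⟨Φ.mem_cyc_iff.2 fun c hc =>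
      Φ.smul_mem_finOrderReturn (Φ.mem_cyc_iff.1 hx.1 c hc) g, fun h => hx.2 ?_⟩
    simpa using Φ.fixedPoints.smul_mem g⁻¹ h

theorem isInvariant_cycNonfixed (Φ : EquivariantFlow G X) (γ : ℝ) :
    IsInvariant Φ.toFlow (Φ.cycNonfixed γ : Set X) := fun t x hx => by
  refine ⟨Φ.mem_cyc_iff.2 fun c hc =>
    Φ.flow_mem_finOrderReturn (Φ.mem_cyc_iff.1 hx.1 c hc) t, fun h => hx.2 ?_⟩
  have := Φ.isInvariant_fixedPoints (-t) h
  rwa [← Flow.map_add, neg_add_cancel, Flow.map_zero_apply] at this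

theorem isLocallyClosed_cycNonfixed [LocallyCompactSpace X] [ContinuousConstSMul G X]
    (Φ : EquivariantFlow G X) (γ : ℝ) : IsLocallyClosed (Φ.cycNonfixed γ : Set X) := by
  have : (Φ.cycNonfixed γ : Set X) = closure (Φ.cyc γ) ∩ (Φ.fixedPoints : Set X)ᶜ := by
    ext x
    refine ⟨fun hx => ⟨subset_closure hx.1, hx.2⟩, fun hx => ⟨Φ.mem_cyc_iff.2 fun c hc => ?_, hx.2⟩⟩
    exact Φ.mem_finOrderReturn_of_mem_closure
      (closure_mono (fun y hy => Φ.mem_cyc_iff.1 hy c hc) hx.1) hx.2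
  rw [this]
  exact isClosed_closure.isLocallyClosed.inter Φ.isClosed_fixedPoints.isOpen_compl.isLocallyClosed

end EquivariantFlow

/-! ### The cover of `X_cyc` -/

theorem mainTheorem5 {G X : Type*} [Group G] [Countable G] [MetricSpace X] [MulAction G X]
    [IsIsometricSMul G X] [ProperlyDiscontinuousSMul G X]
    [LocallyCompactSpace X] [SecondCountableTopology X]
    (Φ : EquivariantFlow G X) (γ : ℝ) :
    ∃ 𝒱 : Set (Set X),
      (∀ (g : G), ∀ V ∈ 𝒱, g • V ∈ 𝒱) ∧
      (∀ V ∈ 𝒱, V ⊆ Φ.cyc γ ∧ IsOpen ((↑) ⁻¹' V : Set (Φ.cyc γ)) ∧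
        IsFamilySubset (finSubgroups G) V) ∧
      collectionDim 𝒱 ≤ 2 * coveringDim X + 1 ∧
      ∀ x ∈ Φ.cyc γ, ∃ V ∈ 𝒱, Φ.orbit x ⊆ V := by
  classical
  rcases (Φ.cyc γ).eq_empty_or_nonempty with h | ⟨x₀, hx₀⟩
  · refine ⟨∅, by simp, by simp, sSup_le ?_, by simp [h]⟩
    rintro _ ⟨n, s, -, hs, hcard, -⟩
    rw [Finset.coe_eq_empty.1 (subset_empty_iff.1 hs)] at hcard
    simp at hcard
  have hγ : 0 ≤ γ := by
    by_contra! hγ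
    obtain ⟨t, ht, htc, -⟩ := Φ.mem_cyc_iff.1 hx₀ 0 hγ
    linarith
  obtain ⟨d, hd⟩ : ∃ d : ℕ∞, coveringDim X = d := by
    cases h : coveringDim X with
    | bot => exact ((isEmpty_of_coveringDim_eq_bot h).false x₀).elim
    | coe d => exact ⟨d, rfl⟩
  obtain ⟨𝒱, h𝒱g, h𝒱, h𝒱d, h𝒱c⟩ := Φ.exists_cover_of_isLocallyClosed hd Φ.fixedPoints
    Φ.isInvariant_fixedPoints Φ.isClosed_fixedPoints.isLocallyClosed
    (fun x => ⟨1, .of_forall fun y hy => ⟨1, one_pos, le_rfl, hy 1⟩⟩) (Or.inl fun x hx => hx)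
  obtain ⟨𝒲, h𝒲g, h𝒲, h𝒲d, h𝒲c⟩ := Φ.exists_cover_of_isLocallyClosed hd (Φ.cycNonfixed γ)
    (Φ.isInvariant_cycNonfixed γ) (Φ.isLocallyClosed_cycNonfixed γ)
    (fun x => (Φ.eventually_finOrderReturn_period_le (γ + 1) x).imp fun P hP =>
      hP.mono fun y hy hyA => hy (Φ.mem_cyc_iff.1 hyA.1 (γ + 1) (by linarith)))
    (Or.inr fun x hx => hx.2)
  let F : Set X := (Φ.fixedPoints : Set X)
  have hFcyc : F ⊆ Φ.cyc γ := Φ.fixedPoints_subset_cyc hγ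
  have hsmulF : ∀ g : G, g • F = F := fun g => by
    refine Subset.antisymm (smul_set_subset_iff.2 fun x hx => Φ.fixedPoints.smul_mem g hx)
      fun x hx => mem_smul_set_iff_inv_smul_mem.2 (Φ.fixedPoints.smul_mem g⁻¹ hx)
  have hsmulcyc : ∀ g : G, g • Φ.cyc γ = Φ.cyc γ := fun g => by
    have hmem : ∀ (g : G), ∀ x ∈ Φ.cyc γ, g • x ∈ Φ.cyc γ := fun g x hx =>
      Φ.mem_cyc_iff.2 fun c hc => Φ.smul_mem_finOrderReturn (Φ.mem_cyc_iff.1 hx c hc) g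
    exact Subset.antisymm (smul_set_subset_iff.2 fun x hx => hmem g x hx)
      fun x hx => mem_smul_set_iff_inv_smul_mem.2 (hmem g⁻¹ x hx)
  let f : Set Φ.fixedPoints → Set X := fun V => metricExtension F ((↑) '' V) ∩ Φ.cyc γ
  have hfF : ∀ V, IsOpen V → f V ∩ F = (↑) '' V := by
    intro V hV
    have hcl : IsClosed (F \ (↑) '' V) := by
      have : F \ (↑) '' V = ((↑) '' Vᶜ : Set X) := by
        rw [image_compl_eq_range_sdiff_image Subtype.val_injective, Subtype.range_coe]
      rw [this]
      exact Φ.isClosed_fixedPoints.isClosedMap_subtype_val _ hV.isClosed_compl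
    rw [inter_assoc, inter_eq_right.2 hFcyc, metricExtension_inter _ hcl]
    rintro _ ⟨x, -, rfl⟩
    exact x.2
  obtain ⟨hf1, hf2, hf3⟩ := IsFamilySubset.image_family (G := G) (f := f) (𝒱 := 𝒱)
    (fun g V => by
      change metricExtension F ((↑) '' (g • V)) ∩ _ = g • (metricExtension F ((↑) '' V) ∩ _)
      rw [image_smul_comm (Subtype.val : Φ.fixedPoints → X) g V fun _ => rfl,
        metricExtension_smul g (hsmulF g), smul_set_inter, hsmulcyc])
    (fun t ht x hx => by
      obtain ⟨y, hy, hyt⟩ := exists_mem_of_mem_metricExtension (F := F)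
        (t := t.image ((↑) '' ·)) (ht.image _) (x := x) (by
          intro V hV
          obtain ⟨W, hW, rfl⟩ := Finset.mem_image.1 hV
          exact (hx W hW).1)
      refine ⟨⟨y, hy⟩, fun V hV => ?_⟩
      obtain ⟨z, hz, hzy⟩ := hyt _ (Finset.mem_image_of_mem _ hV)
      exact (Subtype.ext hzy : z = ⟨y, hy⟩) ▸ hz)
    h𝒱g
    (fun V hV W hW hVW => Subtype.val_injective.image_injective (by
      rw [← hfF V (h𝒱 V hV).1, ← hfF W (h𝒱 W hW).1, hVW]))
    (fun V hV => (h𝒱 V hV).2) h𝒱d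
  obtain ⟨hg1, hg2, hg3⟩ := IsFamilySubset.image_family (G := G)
    (f := fun V : Set (Φ.cycNonfixed γ) => ((↑) '' V : Set X)) (𝒱 := 𝒲)
    (fun g V => image_smul_comm (Subtype.val : Φ.cycNonfixed γ → X) g V fun _ => rfl)
    (fun t ht x hx => by
      obtain ⟨W, hW⟩ := ht
      obtain ⟨y, -, rfl⟩ := hx W hW
      refine ⟨y, fun V hV => ?_⟩
      obtain ⟨z, hz, hzy⟩ := hx V hV
      exact Subtype.ext hzy ▸ hz)
    h𝒲g (Subtype.val_injective.image_injective.injOn) (fun V hV => (h𝒲 V hV).2) h𝒲d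
  refine ⟨f '' 𝒱 ∪ (fun V : Set (Φ.cycNonfixed γ) => ((↑) '' V : Set X)) '' 𝒲, ?_, ?_, ?_, ?_⟩
  · rintro g V (hV | hV)
    exacts [Or.inl (hf1 g V hV), Or.inr (hg1 g V hV)]
  · rintro V (hV | hV)
    · refine ⟨?_, ?_, hf2 V hV⟩ <;> obtain ⟨V, -, rfl⟩ := hV
      · exact inter_subset_right
      · rw [preimage_inter, Subtype.coe_preimage_self, inter_univ]
        exact (isOpen_metricExtension _ _).preimage continuous_subtype_val
    · refine ⟨?_, ?_, hg2 V hV⟩ <;> obtain ⟨V, hV, rfl⟩ := hV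
      · rintro _ ⟨x, -, rfl⟩
        exact x.2.1
      · obtain ⟨O, hO, rfl⟩ := isOpen_induced_iff.1 (h𝒲 V hV).1
        have : ((↑) ⁻¹' ((↑) '' ((↑) ⁻¹' O : Set (Φ.cycNonfixed γ)) : Set X) : Set (Φ.cyc γ)) =
            (↑) ⁻¹' (O ∩ Fᶜ) := by
          ext x
          constructor
          · rintro ⟨y, hy, hyx⟩
            rw [mem_preimage, ← hyx]
            exact ⟨hy, y.2.2⟩
          · rintro ⟨hxO, hxF⟩
            exact ⟨⟨x, x.2, hxF⟩, hxO, rfl⟩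
        rw [this]
        exact (hO.inter Φ.isClosed_fixedPoints.isOpen_compl).preimage continuous_subtype_val
  · rw [hd]
    refine (collectionDim_union_le hf3 hg3).trans (le_of_eq ?_)
    rw [← two_mul]
    rfl
  · intro x hx
    by_cases hxF : x ∈ F
    · obtain ⟨V, hV, hxV⟩ := h𝒱c ⟨x, hxF⟩
      refine ⟨f V, Or.inl ⟨V, hV, rfl⟩, hxV.trans ?_⟩
      rw [← hfF V (h𝒱 V hV).1]
      exact inter_subset_left
    · obtain ⟨V, hV, hxV⟩ := h𝒲c ⟨x, hx, hxF⟩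
      exact ⟨_, Or.inr ⟨V, hV, rfl⟩, hxV⟩
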